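/- **Conventions.** Let $k$ be a commutative ring (for example a field). Let $\mathcal C$ be an abelian $k$-linear monoidal category with $k$-bilinear tensor product, and let $\mathcal M$ be an abelian $k$-linear category that is a left $\mathcal C$-module category with $k$-bilinear action $\triangleright\colon \mathcal C\times\mathcal M\to\mathcal M$. Let $X\in\mathcal M$. The functor $-\triangleright X\colon\mathcal C\to\mathcal M$ is a strong $\mathcal C$-module functor via the associator of the action. An *equivalence of $\mathcal C$-module categories* is a $k$-linear equivalence of categories that carries the structure of a strong $\mathcal C$-module functor. * $X$ is *closed* if $-\triangleright X$ has a right adjoint $[X,-]$; then $[X,-]$ is a lax $\mathcal C$-module functor and $T=[X,-\triangleright X]$ is a lax $\mathcal C$-module monad on $\mathcal C$. $X$ is *coclosed* if $-\triangleright X$ has a left adjoint $\langle X,-\rangle$; then $S=\langle X,-\triangleright X\rangle$ is an oplax $\mathcal C$-module comonad on $\mathcal C$. * $X$ is *$\mathcal C$-projective* if $P\triangleright X$ is projective for every projective $P\in\mathcal C$, and a *$\mathcal C$-generator* if every projective object of $\mathcal M$ is a direct summand of $P\triangleright X$ for some projective $P\in\mathcal C$. Dually, $X$ is *$\mathcal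 C$-injective* if $I\triangleright X$ is injective for every injective $I\in\mathcal C$, and a *$\mathcal C$-cogenerator* if every injective object of $\mathcal M$ is a direct summand of $I\triangleright X$ for some injective $I\in\mathcal C$. * For a lax $\mathcal C$-module monad $T$ on $\mathcal C$, with coherence morphisms $\tau_{V,W}\colon V\otimes TW\to T(V\otimes W)$, the Kleisli category $\mathbf{Kl}(T)$ is a $\mathcal C$-module category: $V\triangleright W=V\otimes W$ on objects, and for a Kleisli morphism $f\colon W\to TW'$ the morphism $V\triangleright f$ is $V\otimes W\to V\otimes TW'\xrightarrow{\tau}T(V\otimes W')$. A ($k$-bilinear) $\mathcal C$-module structure on the Eilenberg–Moore category $\mathbf{EM}(T)$ is *extended* if the canonical functor $\mathbf{Kl}(T)\to\mathbf{EM}(T)$, $W\mapsto(TW,\mu_W)$, carries the structure of a strong $\mathcal C$-module functor. It is *given by Linton coequalizers* if it comes with a lax $\mathcal C$-module structure $u_{V,(A,a)}\colon V\otimes A\to V\blacktriangleright(A,a)$ on the forgetful functor $\mathbf{EM}(T)\to\mathcal C$ such that, for all $V$ and $(A,a)$, the $T$-module morphism $T(V\otimes A)\to V\blacktriangleright(A,a)$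 induced by $u$ is a coequalizer in $\mathbf{EM}(T)$ of $$T(V\otimes a),\ \ \mu_{V\otimes A}\circ T(\tau_{V,A})\colon\ T(V\otimes TA)\rightrightarrows T(V\otimes A).$$ * Dually, for an oplax $\mathcal C$-module comonad $S$ with comultiplication $\delta$ and coherence $\sigma_{V,W}\colon S(V\otimes W)\to V\otimes SW$, one has the $\mathcal C$-module category $\mathbf{coKl}(S)$, the *extended* structures on the category $\mathbf{EM}(S)$ of $S$-comodules (those for which $\mathbf{coKl}(S)\to\mathbf{EM}(S)$, $W\mapsto (SW,\delta_W)$, carries the structure of a strong $\mathcal C$-module functor), and those *given by Linton equalizers*: there is an oplax $\mathcal C$-module structure $V\blacktriangleright(A,a)\to V\otimes A$ on the forgetful functor such that the induced $V\blacktriangleright(A,a)\to S(V\otimes A)$ is an equalizer in $\mathbf{EM}(S)$ of $S(V\otimes a)$ and $S(\sigma_{V,A})\circ\delta_{V\otimes A}\colon S(V\otimes A)\rightrightarrows S(V\otimes SA)$. **Theorem.** 1. Assume that $\mathcal C$ and $\mathcal M$ have enough projectives and that $X$ is closed, $\mathcal C$-projective and a $\mathcal C$-generator. Then $\mathbf{EM}([X,-\triangleright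 X])$ has a $k$-bilinear $\mathcal C$-module structure extended from $\mathbf{Kl}([X,-\triangleright X])$ such that the comparison functor $$\mathcal M\longrightarrow\mathbf{EM}([X,-\triangleright X]),\qquad M\mapsto[X,M],$$ is an equivalence of $\mathcal C$-module categories. If moreover $V\triangleright-\colon\mathcal M\to\mathcal M$ is right exact for every $V\in\mathcal C$, then this structure is the one given by Linton coequalizers. 2. Assume that $\mathcal C$ and $\mathcal M$ have enough injectives and that $X$ is coclosed, $\mathcal C$-injective and a $\mathcal C$-cogenerator. Then $\mathbf{EM}(\langle X,-\triangleright X\rangle)$ has a $k$-bilinear $\mathcal C$-module structure extended from $\mathbf{coKl}(\langle X,-\triangleright X\rangle)$ such that the comparison functor $$\mathcal M\longrightarrow\mathbf{EM}(\langle X,-\triangleright X\rangle),\qquad M\mapsto\langle X,M\rangle,$$ is an equivalence of $\mathcal C$-module categories. If moreover $V\triangleright-\colon\mathcal M\to\mathcal M$ is left exact for every $V\in\mathcal C$, then this structure is the one given by Linton equalizers. -/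

import Mathlib

open CategoryTheory CategoryTheory.Limits MonoidalCategory MonoidalLeftAction

universe w v u v₁ u₁ v₂ u₂

namespace ModuleReconstruction

/-! ### Module categories and strong module functors

A left `C`-module category is `MonoidalLeftAction C D`; lax, oplax and strong `C`-module functors are
`Functor.LaxLeftLinear`, `Functor.OplaxLeftLinear` and `Functor.LeftLinear`. -/

section Linear

variable (k : Type w) [CommRing k] (C : Type u₁) [Category.{v₁} C] [MonoidalCategory C]
  [Preadditive C] [Linear k C]

/-- The action of `C` on `D` is biadditive on morphisms. -/
class PreadditiveLeftAction (D : Type u₂) [Category.{v₂} D] [Preadditive D]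
    [MonoidalLeftAction C D] : Prop where
  add_homLeft {c c' : C} (f g : c ⟶ c') (d : D) : (f + g) ⊵ₗ d = f ⊵ₗ d + g ⊵ₗ d
  homRight_add (c : C) {d d' : D} (f g : d ⟶ d') : c ⊴ₗ (f + g) = c ⊴ₗ f + c ⊴ₗ g

/-- The action of `C` on `D` is `k`-bilinear on morphisms. -/
class LinearLeftAction (D : Type u₂) [Category.{v₂} D] [Preadditive D] [Linear k D]
    [MonoidalLeftAction C D] : Prop extends PreadditiveLeftAction C D where
  smul_homLeft (r : k) {c c' : C} (f : c ⟶ c') (d : D) : (r • f) ⊵ₗ d = r • f ⊵ₗ d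
  homRight_smul (r : k) (c : C) {d d' : D} (f : d ⟶ d') : c ⊴ₗ (r • f) = r • c ⊴ₗ f

/-- `F` is an equivalence of `k`-linear `C`-module categories: a `k`-linear equivalence of categories
that admits the structure of a strong `C`-module functor. -/
structure IsModuleEquivalence {D : Type u} [Category.{v} D] [Preadditive D] [Linear k D]
    [MonoidalLeftAction C D] {E : Type u₂} [Category.{v₂} E] [Preadditive E] [Linear k E]
    [MonoidalLeftAction C E] (F : D ⥤ E) : Prop where
  isEquivalence : F.IsEquivalence
  additive : F.Additive
  linear : F.Linear k
  strong : Nonempty (F.LeftLinear C)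

end Linear

section EvaluationFunctor

variable {C : Type u₁} [Category.{v₁} C] [MonoidalCategory C]
  {D : Type u₂} [Category.{v₂} D] [MonoidalLeftAction C D]

/-- `- ▷ X : C ⥤ D` is a strong `C`-module functor; its coherence is the associator of the action. -/
instance actionRightLeftLinear (X : D) : (actionRight (C := C) X).LeftLinear C where
  μₗ c d := (αₗ c d X).inv
  δₗ c d := (αₗ c d X).hom
  μₗ_naturality_left {c c'} f d := by
    change f ⊵ₗ (d ⊙ₗ X) ≫ (αₗ c' d X).inv = (αₗ c d X).inv ≫ (f ▷ d) ⊵ₗ X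
    simp
  μₗ_naturality_right c {d d'} f := by
    change c ⊴ₗ f ⊵ₗ X ≫ (αₗ c d' X).inv = (αₗ c d X).inv ≫ (c ◁ f) ⊵ₗ X
    simp
  μₗ_associativity c c' d := by
    change (αₗ (c ⊗ c') d X).inv ≫ (α_ c c' d).hom ⊵ₗ X =
      (αₗ c c' (d ⊙ₗ X)).hom ≫ c ⊴ₗ (αₗ c' d X).inv ≫ (αₗ c (c' ⊗ d) X).inv
    rw [Iso.inv_comp_eq, ← cancel_mono (αₗ c (c' ⊗ d) X).hom,
      ← cancel_mono (c ⊴ₗ (αₗ c' d X).hom)]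
    simp
  μₗ_unitality d := by
    change (λₗ (d ⊙ₗ X)).hom = (αₗ (𝟙_ C) d X).inv ≫ (λ_ d).hom ⊵ₗ X
    simp
  δₗ_naturality_left {c c'} f d := by
    change (f ▷ d) ⊵ₗ X ≫ (αₗ c' d X).hom = (αₗ c d X).hom ≫ f ⊵ₗ (d ⊙ₗ X)
    simp
  δₗ_naturality_right c {d d'} f := by
    change (c ◁ f) ⊵ₗ X ≫ (αₗ c d' X).hom = (αₗ c d X).hom ≫ c ⊴ₗ f ⊵ₗ X
    simp
  δₗ_associativity c c' d := (associator_actionHom c c' d X).symm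
  δₗ_unitality_inv d := by
    change (λₗ (d ⊙ₗ X)).inv = (λ_ d).inv ⊵ₗ X ≫ (αₗ (𝟙_ C) d X).hom
    have h : (αₗ (𝟙_ C) d X).hom ≫ (λₗ[C] (d ⊙ₗ X)).hom ≫ (λ_ d).inv ⊵ₗ X = 𝟙 _ := by
      rw [← leftUnitor_actionHom_assoc, hom_inv_actionHomLeft]
    rw [← cancel_epi (λₗ[C] (d ⊙ₗ X)).hom, ← cancel_epi (αₗ (𝟙_ C) d X).hom, Iso.hom_inv_id,
      Category.comp_id]
    simpa using (congr_arg (· ≫ (αₗ (𝟙_ C) d X).hom) h).symm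
  μₗ_comp_δₗ c d := (αₗ c d X).inv_hom_id
  δₗ_comp_μₗ c d := (αₗ c d X).hom_inv_id

end EvaluationFunctor

section EvaluationFunctorLinear

variable {k : Type w} [CommRing k] {C : Type u₁} [Category.{v₁} C] [MonoidalCategory C]
  [Preadditive C] [Linear k C]
  {D : Type u₂} [Category.{v₂} D] [Preadditive D] [Linear k D] [MonoidalLeftAction C D]

instance actionRight_additive [PreadditiveLeftAction C D] (X : D) :
    (actionRight (C := C) X).Additive where
  map_add {_ _ f g} := PreadditiveLeftAction.add_homLeft f g X

instance actionRight_linear [LinearLeftAction k C D] (X : D) :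
    (actionRight (C := C) X).Linear k where
  map_smul f r := LinearLeftAction.smul_homLeft r f X

end EvaluationFunctorLinear

/-! ### Lax module monads and oplax module comonads -/

section Monads

variable (C : Type u₁) [Category.{v₁} C] [MonoidalCategory C]
  {D : Type u₂} [Category.{v₂} D] [MonoidalLeftAction C D]

open Functor Functor.LaxLeftLinear Functor.OplaxLeftLinear

/-- A lax `C`-module monad: a monad whose functor is a lax `C`-module functor and whose unit and
multiplication are `C`-module transformations. -/
class LaxModuleMonad (T : Monad D) extends T.toFunctor.LaxLeftLinear C where
  unit_lineator (c : C) (d : D) :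
    c ⊴ₗ T.η.app d ≫ μₗ c d = T.η.app (c ⊙ₗ d)
  mul_lineator (c : C) (d : D) :
    c ⊴ₗ T.μ.app d ≫ μₗ c d =
      μₗ c (T.obj d) ≫ T.map (μₗ c d) ≫ T.μ.app (c ⊙ₗ d)

/-- An oplax `C`-module comonad. -/
class OplaxModuleComonad (S : Comonad D) extends S.toFunctor.OplaxLeftLinear C where
  counit_lineator (c : C) (d : D) :
    δₗ c d ≫ c ⊴ₗ S.ε.app d = S.ε.app (c ⊙ₗ d)
  comul_lineator (c : C) (d : D) :
    δₗ c d ≫ c ⊴ₗ S.δ.app d =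
      S.δ.app (c ⊙ₗ d) ≫ S.map (δₗ c d) ≫ δₗ c (S.obj d)

variable {C}

section Adjunction

variable {E : Type u} [Category.{v} E] {F : D ⥤ E} {U : E ⥤ D}

/-- The counit `F U e ⟶ e`. -/
def counitAt (adj : F ⊣ U) (e : E) : F.obj (U.obj e) ⟶ e := adj.counit.app e

/-- The unit `d ⟶ U F d`. -/
def unitAt (adj : F ⊣ U) (d : D) : d ⟶ U.obj (F.obj d) := adj.unit.app d

lemma counitAt_naturality (adj : F ⊣ U) {e e' : E} (f : e ⟶ e') :
    F.map (U.map f) ≫ counitAt adj e' = counitAt adj e ≫ f :=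
  adj.counit_naturality f

lemma unitAt_naturality (adj : F ⊣ U) {d d' : D} (f : d ⟶ d') :
    unitAt adj d ≫ U.map (F.map f) = f ≫ unitAt adj d' :=
  adj.unit_naturality f

lemma map_unitAt_comp_counitAt (adj : F ⊣ U) (d : D) :
    F.map (unitAt adj d) ≫ counitAt adj (F.obj d) = 𝟙 _ :=
  adj.left_triangle_components d

lemma unitAt_comp_map_counitAt (adj : F ⊣ U) (e : E) :
    unitAt adj (U.obj e) ≫ U.map (counitAt adj e) = 𝟙 _ :=
  adj.right_triangle_components e

lemma hom_ext_of_counitAt (adj : F ⊣ U) {d : D} {e : E} {f g : d ⟶ U.obj e}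
    (h : F.map f ≫ counitAt adj e = F.map g ≫ counitAt adj e) : f = g := by
  apply (adj.homEquiv d e).symm.injective
  simpa [Adjunction.homEquiv_counit, counitAt] using h

lemma hom_ext_of_unitAt (adj : F ⊣ U) {d : D} {e : E} {f g : F.obj d ⟶ e}
    (h : unitAt adj d ≫ U.map f = unitAt adj d ≫ U.map g) : f = g := by
  apply (adj.homEquiv d e).injective
  simpa [Adjunction.homEquiv_unit, unitAt] using h

variable [MonoidalLeftAction C E]

/-- The coherence `c ▷ U e ⟶ U F (c ▷ U e) ⟶ U (c ▷ F U e) ⟶ U (c ▷ e)` on the right adjoint of an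
oplax `C`-module functor. -/
def rightAdjointLineator (adj : F ⊣ U) [F.OplaxLeftLinear C] (c : C) (e : E) :
    c ⊙ₗ U.obj e ⟶ U.obj (c ⊙ₗ e) :=
  unitAt adj (c ⊙ₗ U.obj e) ≫ U.map (δₗ F c (U.obj e) ≫ c ⊴ₗ counitAt adj e)

lemma map_rightAdjointLineator (adj : F ⊣ U) [F.OplaxLeftLinear C] (c : C) (e : E) :
    F.map (rightAdjointLineator adj c e) ≫ counitAt adj (c ⊙ₗ e) =
      δₗ F c (U.obj e) ≫ c ⊴ₗ counitAt adj e := by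
  rw [rightAdjointLineator, F.map_comp, Category.assoc, counitAt_naturality, ← Category.assoc,
    map_unitAt_comp_counitAt, Category.id_comp]

/-- Doctrinal adjunction: the right adjoint of an oplax `C`-module functor is a lax `C`-module
functor. -/
@[reducible]
def rightAdjointLax (adj : F ⊣ U) [F.OplaxLeftLinear C] : U.LaxLeftLinear C where
  μₗ c e := rightAdjointLineator adj c e
  μₗ_naturality_left {c c'} f e := by
    apply hom_ext_of_counitAt adj
    simp only [Functor.map_comp, Category.assoc, map_rightAdjointLineator, counitAt_naturality]
    rw [← Category.assoc, δₗ_naturality_left, Category.assoc, ← action_exchange,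
      ← Category.assoc (F.map _), map_rightAdjointLineator, Category.assoc]
  μₗ_naturality_right c {e e'} f := by
    apply hom_ext_of_counitAt adj
    simp only [Functor.map_comp, Category.assoc, map_rightAdjointLineator, counitAt_naturality]
    rw [← Category.assoc, δₗ_naturality_right, Category.assoc, ← actionHomRight_comp,
      ← Category.assoc (F.map _), map_rightAdjointLineator, Category.assoc, ← actionHomRight_comp,
      counitAt_naturality]
  μₗ_associativity c c' e := by
    apply hom_ext_of_counitAt adj
    simp only [Functor.map_comp, Category.assoc, map_rightAdjointLineator, counitAt_naturality]
    rw [← Category.assoc (F.map (rightAdjointLineator adj _ _)), map_rightAdjointLineator,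
      ← Category.assoc (F.map (c ⊴ₗ _)), δₗ_naturality_right, Category.assoc, Category.assoc,
      ← actionHomRight_comp, map_rightAdjointLineator]
    have h := δₗ_associativity F c c' (U.obj e)
    simp only [actionHomRight_comp, tensor_actionHomRight, Category.assoc, Iso.inv_hom_id,
      Category.comp_id]
    rw [← Category.assoc, h]
    simp
  μₗ_unitality e := by
    apply hom_ext_of_counitAt adj
    simp only [Functor.map_comp, Category.assoc, counitAt_naturality]
    rw [← Category.assoc (F.map (rightAdjointLineator adj _ _)), map_rightAdjointLineator,
      Category.assoc, ← actionUnitIso_hom_naturality, ← Category.assoc, δₗ_unitality_hom]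

/-- The coherence `F (c ▷ d) ⟶ F (c ▷ U F d) ⟶ F U (c ▷ F d) ⟶ c ▷ F d` on the left adjoint of a lax
`C`-module functor. -/
def leftAdjointLineator (adj : F ⊣ U) [U.LaxLeftLinear C] (c : C) (d : D) :
    F.obj (c ⊙ₗ d) ⟶ c ⊙ₗ F.obj d :=
  F.map (c ⊴ₗ unitAt adj d ≫ μₗ U c (F.obj d)) ≫ counitAt adj (c ⊙ₗ F.obj d)

lemma map_leftAdjointLineator (adj : F ⊣ U) [U.LaxLeftLinear C] (c : C) (d : D) :
    unitAt adj (c ⊙ₗ d) ≫ U.map (leftAdjointLineator adj c d) =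
      c ⊴ₗ unitAt adj d ≫ μₗ U c (F.obj d) := by
  rw [leftAdjointLineator, U.map_comp, ← Category.assoc, unitAt_naturality, Category.assoc,
    unitAt_comp_map_counitAt, Category.comp_id]

/-- Doctrinal adjunction: the left adjoint of a lax `C`-module functor is an oplax `C`-module
functor. -/
@[reducible]
def leftAdjointOplax (adj : F ⊣ U) [U.LaxLeftLinear C] : F.OplaxLeftLinear C where
  δₗ c d := leftAdjointLineator adj c d
  δₗ_naturality_left {c c'} f d := by
    apply hom_ext_of_unitAt adj
    simp only [Functor.map_comp]
    rw [← Category.assoc, unitAt_naturality, Category.assoc, map_leftAdjointLineator,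
      ← Category.assoc (unitAt adj _), map_leftAdjointLineator, Category.assoc,
      ← μₗ_naturality_left, ← Category.assoc, ← action_exchange, Category.assoc]
  δₗ_naturality_right c {d d'} f := by
    apply hom_ext_of_unitAt adj
    simp only [Functor.map_comp]
    rw [← Category.assoc, unitAt_naturality, Category.assoc, map_leftAdjointLineator,
      ← Category.assoc (unitAt adj _), map_leftAdjointLineator, Category.assoc,
      ← μₗ_naturality_right, ← Category.assoc, ← Category.assoc, ← actionHomRight_comp,
      ← actionHomRight_comp, unitAt_naturality]
  δₗ_associativity c c' d := by
    apply hom_ext_of_unitAt adj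
    simp only [Functor.map_comp]
    rw [← Category.assoc, map_leftAdjointLineator, ← Category.assoc (unitAt adj _),
      unitAt_naturality, Category.assoc, Category.assoc, ← Category.assoc (unitAt adj _),
      map_leftAdjointLineator, Category.assoc, μₗ_associativity, ← μₗ_naturality_right,
      ← Category.assoc (c ⊴ₗ _), ← actionHomRight_comp, map_leftAdjointLineator]
    simp
  δₗ_unitality_inv d := by
    apply hom_ext_of_unitAt adj
    simp only [Functor.map_comp]
    rw [← Category.assoc, unitAt_naturality, Category.assoc, map_leftAdjointLineator,
      ← Category.assoc, actionUnitIso_inv_naturality, Category.assoc, μₗ_unitality_inv]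

/-- The composite of two lax `C`-module functors. -/
@[reducible]
def compLax (F : D ⥤ E) (G : E ⥤ D) [F.LaxLeftLinear C] [G.LaxLeftLinear C] :
    (F ⋙ G).LaxLeftLinear C where
  μₗ c d := μₗ G c (F.obj d) ≫ G.map (μₗ F c d)
  μₗ_naturality_left f d := by
    simp [← Functor.map_comp]
  μₗ_naturality_right c d d' f := by
    simp [← Functor.map_comp]
  μₗ_associativity c c' d := by
    have h := congr_arg G.map (μₗ_associativity F c c' d)
    simp only [Functor.map_comp] at h
    simp only [Functor.comp_obj, Functor.comp_map, Category.assoc, actionHomRight_comp]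
    rw [h, μₗ_associativity_assoc, μₗ_naturality_right_assoc]
  μₗ_unitality d := by
    simp [← Functor.map_comp]

/-- The composite of two oplax `C`-module functors. -/
@[reducible]
def compOplax (F : D ⥤ E) (G : E ⥤ D) [F.OplaxLeftLinear C] [G.OplaxLeftLinear C] :
    (F ⋙ G).OplaxLeftLinear C where
  δₗ c d := G.map (δₗ F c d) ≫ δₗ G c (F.obj d)
  δₗ_naturality_left {c c'} f d := by
    simp only [Functor.comp_obj, Functor.comp_map, Category.assoc]
    rw [← δₗ_naturality_left G, ← Category.assoc, ← G.map_comp, δₗ_naturality_left, G.map_comp,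
      Category.assoc]
  δₗ_naturality_right c d d' f := by
    simp only [Functor.comp_obj, Functor.comp_map, Category.assoc]
    rw [← δₗ_naturality_right G, ← Category.assoc, ← G.map_comp, δₗ_naturality_right, G.map_comp,
      Category.assoc]
  δₗ_associativity c c' d := by
    have h := congr_arg G.map (δₗ_associativity F c c' d)
    simp only [Functor.map_comp] at h
    simp only [Functor.comp_obj, Functor.comp_map, Category.assoc, actionHomRight_comp]
    rw [δₗ_associativity, reassoc_of% h, δₗ_naturality_right_assoc]
  δₗ_unitality_inv d := by
    have h := congr_arg G.map (δₗ_unitality_inv F (C := C) d)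
    simp only [Functor.map_comp] at h
    simp only [Functor.comp_obj, Functor.comp_map]
    rw [δₗ_unitality_inv, h, Category.assoc]

/-- The monad `U F` of an adjunction `F ⊣ U` with `F` a strong `C`-module functor is a lax
`C`-module monad. -/
instance toMonadLaxModuleMonad (adj : F ⊣ U) [F.LeftLinear C] : LaxModuleMonad C adj.toMonad where
  toLaxLeftLinear :=
    letI := rightAdjointLax (C := C) adj
    compLax F U
  unit_lineator c d := by
    change c ⊴ₗ unitAt adj d ≫ rightAdjointLineator adj c (F.obj d) ≫ U.map (μₗ F c d) =
      unitAt adj (c ⊙ₗ d)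
    apply hom_ext_of_counitAt adj
    simp only [Functor.map_comp, Category.assoc]
    rw [counitAt_naturality, ← Category.assoc (F.map (rightAdjointLineator adj _ _)),
      map_rightAdjointLineator, Category.assoc, δₗ_naturality_right_assoc,
      ← actionHomRight_comp_assoc, map_unitAt_comp_counitAt, map_unitAt_comp_counitAt]
    simp
  mul_lineator c d := by
    change c ⊴ₗ U.map (counitAt adj (F.obj d)) ≫
        rightAdjointLineator adj c (F.obj d) ≫ U.map (μₗ F c d) =
      (rightAdjointLineator adj c (F.obj (U.obj (F.obj d))) ≫ U.map (μₗ F c (U.obj (F.obj d)))) ≫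
        U.map (F.map (rightAdjointLineator adj c (F.obj d) ≫ U.map (μₗ F c d))) ≫
          U.map (counitAt adj (F.obj (c ⊙ₗ d)))
    let _ := rightAdjointLax (C := C) adj
    have h := μₗ_naturality_right U c (counitAt adj (F.obj d))
    change c ⊴ₗ U.map (counitAt adj (F.obj d)) ≫ rightAdjointLineator adj c (F.obj d) =
      rightAdjointLineator adj c (F.obj (U.obj (F.obj d))) ≫ U.map (c ⊴ₗ counitAt adj (F.obj d)) at h
    rw [reassoc_of% h, Category.assoc]
    simp only [← Functor.map_comp]
    congr 2
    rw [F.map_comp, Category.assoc, counitAt_naturality, ← Category.assoc (F.map _),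
      map_rightAdjointLineator, Category.assoc, LeftLinear.μₗ_comp_δₗ_assoc]

/-- The comonad `F U` of an adjunction `F ⊣ U` with `U` a strong `C`-module functor is an oplax
`C`-module comonad. -/
instance toComonadOplaxModuleComonad (adj : F ⊣ U) [U.LeftLinear C] :
    OplaxModuleComonad C adj.toComonad where
  toOplaxLeftLinear :=
    letI := leftAdjointOplax (C := C) adj
    compOplax U F
  counit_lineator c e := by
    change (F.map (δₗ U c e) ≫ leftAdjointLineator adj c (U.obj e)) ≫ c ⊴ₗ counitAt adj e =
      counitAt adj (c ⊙ₗ e)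
    apply hom_ext_of_unitAt adj
    simp only [Functor.map_comp, Category.assoc]
    rw [← Category.assoc, unitAt_naturality, Category.assoc, ← Category.assoc (unitAt adj _),
      map_leftAdjointLineator, Category.assoc, ← μₗ_naturality_right,
      ← actionHomRight_comp_assoc, unitAt_comp_map_counitAt, unitAt_comp_map_counitAt]
    simp
  comul_lineator c e := by
    change (F.map (δₗ U c e) ≫ leftAdjointLineator adj c (U.obj e)) ≫
        c ⊴ₗ F.map (unitAt adj (U.obj e)) =
      F.map (unitAt adj (U.obj (c ⊙ₗ e))) ≫
        F.map (U.map (F.map (δₗ U c e) ≫ leftAdjointLineator adj c (U.obj e))) ≫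
          F.map (δₗ U c (F.obj (U.obj e))) ≫ leftAdjointLineator adj c (U.obj (F.obj (U.obj e)))
    let _ := leftAdjointOplax (C := C) adj
    have h := δₗ_naturality_right F c (unitAt adj (U.obj e))
    change F.map (c ⊴ₗ unitAt adj (U.obj e)) ≫ leftAdjointLineator adj c (U.obj (F.obj (U.obj e))) =
      leftAdjointLineator adj c (U.obj e) ≫ c ⊴ₗ F.map (unitAt adj (U.obj e)) at h
    rw [Category.assoc, ← h]
    simp only [← Category.assoc, ← Functor.map_comp]
    congr 2
    rw [U.map_comp, ← Category.assoc (unitAt adj _), unitAt_naturality, Category.assoc,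
      Category.assoc, ← Category.assoc (unitAt adj _), map_leftAdjointLineator, Category.assoc,
      LeftLinear.μₗ_comp_δₗ, Category.comp_id]

end Adjunction

/-! ### The module structure on the Kleisli category and its embedding into modules -/

section Kleisli

variable (T : Monad D)

lemma eta_kleisliComp {x y z : D} (f : x ⟶ y) (g : y ⟶ T.obj z) :
    (f ≫ T.η.app y) ≫ T.map g ≫ T.μ.app z = f ≫ g := by
  have h := T.η.naturality g
  simp only [Functor.id_obj, Functor.id_map] at h
  rw [Category.assoc, ← reassoc_of% h, Monad.left_unit]
  exact congr_arg (f ≫ ·) (Category.comp_id g)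

lemma kleisliComp_eta {x y z : D} (g : x ⟶ T.obj y) (f : y ⟶ z) :
    g ≫ T.map (f ≫ T.η.app z) ≫ T.μ.app z = g ≫ T.map f := by
  rw [Functor.map_comp, Category.assoc, Monad.right_unit]
  exact congr_arg (g ≫ ·) (Category.comp_id (T.map f))

variable [LaxModuleMonad C T]

lemma lineator_naturality {c c' : C} {d d' : D} (f : c ⟶ c') (g : d ⟶ d') :
    (f ⊙ₗₘ T.map g) ≫ μₗ T.toFunctor c' d' = μₗ T.toFunctor c d ≫ T.map (f ⊙ₗₘ g) := by
  rw [actionHom_def, actionHom_def, Category.assoc, μₗ_naturality_right, ← Category.assoc,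
    μₗ_naturality_left, Category.assoc, ← T.map_comp]

/-- `c ▷ f` for a Kleisli morphism `f : x ⟶ T y`, namely `c ▷ x ⟶ c ▷ T y ⟶ T (c ▷ y)`. -/
def kleisliWhisker (c : C) {x y : D} (f : x ⟶ T.obj y) :
    (Kleisli.Adjunction.toKleisli T).obj (c ⊙ₗ x) ⟶ (Kleisli.Adjunction.toKleisli T).obj (c ⊙ₗ y) :=
  Kleisli.Hom.mk (c ⊴ₗ f ≫ μₗ T.toFunctor c y)

lemma kleisliWhisker_toKleisli (c : C) {x y : D} (f : x ⟶ y) :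
    kleisliWhisker T c (f ≫ T.η.app y) = (Kleisli.Adjunction.toKleisli T).map (c ⊴ₗ f) := by
  apply Kleisli.hom_ext
  change c ⊴ₗ (f ≫ T.η.app y) ≫ μₗ T.toFunctor c y = c ⊴ₗ f ≫ T.η.app (c ⊙ₗ y)
  rw [actionHomRight_comp, Category.assoc, LaxModuleMonad.unit_lineator]

/-- The action of `C` on the Kleisli category: `c ▷ x` on objects, and `c ▷ f` for `f : x ⟶ T y` is
`c ▷ x ⟶ c ▷ T y ⟶ T (c ▷ y)`. -/
instance kleisliAction : MonoidalLeftAction C (Kleisli T) where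
  actionObj c x := Kleisli.mk T (c ⊙ₗ x.of)
  actionHomLeft f x := (Kleisli.Adjunction.toKleisli T).map (f ⊵ₗ x.of)
  actionHomRight c _ _ f := kleisliWhisker T c f.of
  actionHom {_ c' _ y} f g := Kleisli.Hom.mk ((f ⊙ₗₘ g.of) ≫ μₗ T.toFunctor c' y.of)
  actionAssocIso c c' x := (Kleisli.Adjunction.toKleisli T).mapIso (αₗ c c' x.of)
  actionUnitIso x := (Kleisli.Adjunction.toKleisli T).mapIso (λₗ x.of)
  actionHom_def {c c' x y} f g := by
    apply Kleisli.hom_ext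
    change (f ⊙ₗₘ g.of) ≫ μₗ T.toFunctor c' y.of =
      (f ⊵ₗ x.of ≫ T.η.app (c' ⊙ₗ x.of)) ≫
        T.map (c' ⊴ₗ g.of ≫ μₗ T.toFunctor c' y.of) ≫ T.μ.app (c' ⊙ₗ y.of)
    rw [eta_kleisliComp, actionHom_def, Category.assoc]
  actionHomRight_id c x := by
    apply Kleisli.hom_ext
    exact LaxModuleMonad.unit_lineator c x.of
  id_actionHomLeft c x := by
    apply Kleisli.hom_ext
    change 𝟙 c ⊵ₗ x.of ≫ T.η.app (c ⊙ₗ x.of) = T.η.app (c ⊙ₗ x.of)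
    rw [id_actionHomLeft, Category.id_comp]
  actionHom_comp {c c' c'' x x' x''} f₁ f₂ g₁ g₂ := by
    apply Kleisli.hom_ext
    change ((f₁ ≫ f₂) ⊙ₗₘ (g₁.of ≫ T.map g₂.of ≫ T.μ.app x''.of)) ≫ μₗ T.toFunctor c'' x''.of =
      ((f₁ ⊙ₗₘ g₁.of) ≫ μₗ T.toFunctor c' x'.of) ≫
        T.map ((f₂ ⊙ₗₘ g₂.of) ≫ μₗ T.toFunctor c'' x''.of) ≫ T.μ.app (c'' ⊙ₗ x''.of)
    have h : f₂ ⊙ₗₘ (T.map g₂.of ≫ T.μ.app x''.of) =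
        (f₂ ⊙ₗₘ T.map g₂.of) ≫ c'' ⊴ₗ T.μ.app x''.of := by
      rw [← id_actionHom, ← actionHom_comp, Category.comp_id]
    rw [actionHom_comp, h, Category.assoc, Category.assoc, LaxModuleMonad.mul_lineator,
      Category.assoc, T.map_comp, Category.assoc, ← Category.assoc (f₂ ⊙ₗₘ _),
      lineator_naturality, Category.assoc]
  actionAssocIso_hom_naturality {c₁ c₂ c₃ c₄ x y} f g h := by
    apply Kleisli.hom_ext
    change (((f ⊗ₘ g) ⊙ₗₘ h.of) ≫ μₗ T.toFunctor (c₂ ⊗ c₄) y.of) ≫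
        T.map ((αₗ c₂ c₄ y.of).hom ≫ T.η.app _) ≫ T.μ.app _ =
      ((αₗ c₁ c₃ x.of).hom ≫ T.η.app _) ≫
        T.map ((f ⊙ₗₘ ((g ⊙ₗₘ h.of) ≫ μₗ T.toFunctor c₄ y.of)) ≫
          μₗ T.toFunctor c₂ (c₄ ⊙ₗ y.of)) ≫ T.μ.app _
    have h' : f ⊙ₗₘ ((g ⊙ₗₘ h.of) ≫ μₗ T.toFunctor c₄ y.of) =
        (f ⊙ₗₘ g ⊙ₗₘ h.of) ≫ c₂ ⊴ₗ μₗ T.toFunctor c₄ y.of := by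
      rw [← id_actionHom, ← actionHom_comp, Category.comp_id]
    rw [kleisliComp_eta, eta_kleisliComp, Category.assoc, μₗ_associativity, h',
      ← Category.assoc, actionAssocIso_hom_naturality, Category.assoc, Category.assoc]
  actionUnitIso_hom_naturality {x y} f := by
    apply Kleisli.hom_ext
    change ((λₗ[C] x.of).hom ≫ T.η.app x.of) ≫ T.map f.of ≫ T.μ.app y.of =
      (𝟙_ C ⊴ₗ f.of ≫ μₗ T.toFunctor (𝟙_ C) y.of) ≫
        T.map ((λₗ[C] y.of).hom ≫ T.η.app y.of) ≫ T.μ.app y.of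
    rw [kleisliComp_eta, eta_kleisliComp, Category.assoc, ← μₗ_unitality,
      actionUnitIso_hom_naturality]
  whiskerLeft_actionHomLeft c c' c'' f x := by
    change (Kleisli.Adjunction.toKleisli T).map ((c ◁ f) ⊵ₗ x.of) =
      (Kleisli.Adjunction.toKleisli T).map (αₗ c c' x.of).hom ≫
        kleisliWhisker T c (f ⊵ₗ x.of ≫ T.η.app (c'' ⊙ₗ x.of)) ≫
        (Kleisli.Adjunction.toKleisli T).map (αₗ c c'' x.of).inv
    rw [kleisliWhisker_toKleisli, ← Functor.map_comp, ← Functor.map_comp,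
      whiskerLeft_actionHomLeft]
  whiskerRight_actionHomLeft {c c'} c'' f x := by
    change (Kleisli.Adjunction.toKleisli T).map ((f ▷ c'') ⊵ₗ x.of) =
      (Kleisli.Adjunction.toKleisli T).map (αₗ c c'' x.of).hom ≫
        (Kleisli.Adjunction.toKleisli T).map (f ⊵ₗ (c'' ⊙ₗ x.of)) ≫
        (Kleisli.Adjunction.toKleisli T).map (αₗ c' c'' x.of).inv
    rw [← Functor.map_comp, ← Functor.map_comp, whiskerRight_actionHomLeft]
  associator_actionHom c₁ c₂ c₃ x := by
    change (Kleisli.Adjunction.toKleisli T).map ((α_ c₁ c₂ c₃).hom ⊵ₗ x.of) ≫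
        (Kleisli.Adjunction.toKleisli T).map (αₗ c₁ (c₂ ⊗ c₃) x.of).hom ≫
        kleisliWhisker T c₁ ((αₗ c₂ c₃ x.of).hom ≫ T.η.app (c₂ ⊙ₗ c₃ ⊙ₗ x.of)) =
      (Kleisli.Adjunction.toKleisli T).map (αₗ (c₁ ⊗ c₂) c₃ x.of).hom ≫
        (Kleisli.Adjunction.toKleisli T).map (αₗ c₁ c₂ (c₃ ⊙ₗ x.of)).hom
    rw [kleisliWhisker_toKleisli, ← Functor.map_comp, ← Functor.map_comp, ← Functor.map_comp,
      associator_actionHom]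
  leftUnitor_actionHom c x := by
    change (Kleisli.Adjunction.toKleisli T).map ((λ_ c).hom ⊵ₗ x.of) =
      (Kleisli.Adjunction.toKleisli T).map (αₗ (𝟙_ C) c x.of).hom ≫
        (Kleisli.Adjunction.toKleisli T).map (λₗ (c ⊙ₗ x.of)).hom
    rw [← Functor.map_comp, leftUnitor_actionHom]
  rightUnitor_actionHom c x := by
    change (Kleisli.Adjunction.toKleisli T).map ((ρ_ c).hom ⊵ₗ x.of) =
      (Kleisli.Adjunction.toKleisli T).map (αₗ c (𝟙_ C) x.of).hom ≫
        kleisliWhisker T c ((λₗ[C] x.of).hom ≫ T.η.app x.of)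
    rw [kleisliWhisker_toKleisli, ← Functor.map_comp, rightUnitor_actionHom]

/-- The embedding of the Kleisli category into the Eilenberg-Moore category, onto the free modules:
`x ↦ (T x, μ)`, and `f : x ⟶ T y` goes to `T x ⟶ T T y ⟶ T y`. -/
def kleisliToAlgebra (T : Monad D) : Kleisli T ⥤ T.Algebra where
  obj x := T.free.obj x.of
  map {x y} f :=
    { f := T.map f.of ≫ T.μ.app y.of
      h := by
        change T.map (T.map f.of ≫ T.μ.app y.of) ≫ T.μ.app y.of =
          T.μ.app x.of ≫ T.map f.of ≫ T.μ.app y.of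
        have h := T.μ.naturality f.of
        simp only [Functor.comp_map] at h
        rw [T.map_comp, Category.assoc, T.assoc, ← reassoc_of% h] }
  map_id x := by
    apply Monad.Algebra.Hom.ext
    change T.map (T.η.app x.of) ≫ T.μ.app x.of = 𝟙 _
    exact T.right_unit x.of
  map_comp {x y z} f g := by
    apply Monad.Algebra.Hom.ext
    change T.map (f.of ≫ T.map g.of ≫ T.μ.app z.of) ≫ T.μ.app z.of =
      (T.map f.of ≫ T.μ.app y.of) ≫ T.map g.of ≫ T.μ.app z.of
    have h := T.μ.naturality g.of
    simp only [Functor.comp_map] at h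
    rw [T.map_comp, T.map_comp, Category.assoc, Category.assoc, Category.assoc, T.assoc,
      ← reassoc_of% h]

end Kleisli

/-! ### The dual: co-Kleisli categories and comodules -/

section Cokleisli

variable (S : Comonad D)

lemma eps_cokleisliComp {x y z : D} (f : x ⟶ y) (g : S.obj y ⟶ z) :
    S.δ.app x ≫ S.map (S.ε.app x ≫ f) ≫ g = S.map f ≫ g := by
  rw [Functor.map_comp, Category.assoc, ← Category.assoc, Comonad.right_counit]
  exact Category.id_comp _

lemma cokleisliComp_eps {x y z : D} (g : S.obj x ⟶ y) (f : y ⟶ z) :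
    S.δ.app x ≫ S.map g ≫ S.ε.app y ≫ f = g ≫ f := by
  have h := S.ε.naturality g
  simp only [Functor.id_obj, Functor.id_map] at h
  rw [reassoc_of% h, ← Category.assoc, Comonad.left_counit]
  exact Category.id_comp _

variable [OplaxModuleComonad C S]

lemma colineator_naturality {c c' : C} {d d' : D} (f : c ⟶ c') (g : d ⟶ d') :
    S.map (f ⊙ₗₘ g) ≫ δₗ S.toFunctor c' d' = δₗ S.toFunctor c d ≫ (f ⊙ₗₘ S.map g) := by
  rw [actionHom_def, actionHom_def, S.map_comp, Category.assoc, δₗ_naturality_right,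
    ← Category.assoc, δₗ_naturality_left, Category.assoc]

/-- `c ▷ f` for a co-Kleisli morphism `f : S x ⟶ y`, namely `S (c ▷ x) ⟶ c ▷ S x ⟶ c ▷ y`. -/
def cokleisliWhisker (c : C) {x y : D} (f : S.obj x ⟶ y) :
    (Cokleisli.Adjunction.toCokleisli S).obj (c ⊙ₗ x) ⟶
      (Cokleisli.Adjunction.toCokleisli S).obj (c ⊙ₗ y) :=
  Cokleisli.Hom.mk (δₗ S.toFunctor c x ≫ c ⊴ₗ f)

lemma cokleisliWhisker_toCokleisli (c : C) {x y : D} (f : x ⟶ y) :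
    cokleisliWhisker S c (S.ε.app x ≫ f) =
      (Cokleisli.Adjunction.toCokleisli S).map (c ⊴ₗ f) := by
  apply Cokleisli.hom_ext
  change δₗ S.toFunctor c x ≫ c ⊴ₗ (S.ε.app x ≫ f) = S.ε.app (c ⊙ₗ x) ≫ c ⊴ₗ f
  rw [actionHomRight_comp, ← Category.assoc, OplaxModuleComonad.counit_lineator]

/-- The action of `C` on the co-Kleisli category: `c ▷ x` on objects, and `c ▷ f` for `f : S x ⟶ y`
is `S (c ▷ x) ⟶ c ▷ S x ⟶ c ▷ y`. -/
instance cokleisliAction : MonoidalLeftAction C (Cokleisli S) where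
  actionObj c x := Cokleisli.mk S (c ⊙ₗ x.of)
  actionHomLeft f x := (Cokleisli.Adjunction.toCokleisli S).map (f ⊵ₗ x.of)
  actionHomRight c _ _ f := cokleisliWhisker S c f.of
  actionHom {c _ x _} f g := Cokleisli.Hom.mk (δₗ S.toFunctor c x.of ≫ (f ⊙ₗₘ g.of))
  actionAssocIso c c' x := (Cokleisli.Adjunction.toCokleisli S).mapIso (αₗ c c' x.of)
  actionUnitIso x := (Cokleisli.Adjunction.toCokleisli S).mapIso (λₗ x.of)
  actionHom_def {c c' x y} f g := by
    apply Cokleisli.hom_ext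
    change δₗ S.toFunctor c x.of ≫ (f ⊙ₗₘ g.of) =
      S.δ.app (c ⊙ₗ x.of) ≫ S.map (S.ε.app (c ⊙ₗ x.of) ≫ f ⊵ₗ x.of) ≫
        δₗ S.toFunctor c' x.of ≫ c' ⊴ₗ g.of
    rw [eps_cokleisliComp, actionHom_def, δₗ_naturality_left_assoc]
  actionHomRight_id c x := by
    apply Cokleisli.hom_ext
    exact OplaxModuleComonad.counit_lineator c x.of
  id_actionHomLeft c x := by
    apply Cokleisli.hom_ext
    change S.ε.app (c ⊙ₗ x.of) ≫ 𝟙 c ⊵ₗ x.of = S.ε.app (c ⊙ₗ x.of)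
    rw [id_actionHomLeft]
    exact Category.comp_id _
  actionHom_comp {c c' c'' x x' x''} f₁ f₂ g₁ g₂ := by
    apply Cokleisli.hom_ext
    change δₗ S.toFunctor c x.of ≫ ((f₁ ≫ f₂) ⊙ₗₘ (S.δ.app x.of ≫ S.map g₁.of ≫ g₂.of)) =
      S.δ.app (c ⊙ₗ x.of) ≫ S.map (δₗ S.toFunctor c x.of ≫ (f₁ ⊙ₗₘ g₁.of)) ≫
        δₗ S.toFunctor c' x'.of ≫ (f₂ ⊙ₗₘ g₂.of)
    have h : (f₁ ≫ f₂) ⊙ₗₘ (S.δ.app x.of ≫ S.map g₁.of ≫ g₂.of) =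
        c ⊴ₗ S.δ.app x.of ≫ (f₁ ⊙ₗₘ S.map g₁.of) ≫ (f₂ ⊙ₗₘ g₂.of) := by
      rw [← id_actionHom, ← actionHom_comp, ← actionHom_comp, Category.id_comp]
    rw [h, S.map_comp, Category.assoc, ← Category.assoc (S.map (f₁ ⊙ₗₘ g₁.of)),
      colineator_naturality, ← Category.assoc, OplaxModuleComonad.comul_lineator]
    simp only [Category.assoc]
  actionAssocIso_hom_naturality {c₁ c₂ c₃ c₄ x y} f g h := by
    apply Cokleisli.hom_ext
    change S.δ.app _ ≫ S.map (δₗ S.toFunctor (c₁ ⊗ c₃) x.of ≫ ((f ⊗ₘ g) ⊙ₗₘ h.of)) ≫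
        S.ε.app _ ≫ (αₗ c₂ c₄ y.of).hom =
      S.δ.app _ ≫ S.map (S.ε.app _ ≫ (αₗ c₁ c₃ x.of).hom) ≫
        δₗ S.toFunctor c₁ (c₃ ⊙ₗ x.of) ≫
          (f ⊙ₗₘ (δₗ S.toFunctor c₃ x.of ≫ (g ⊙ₗₘ h.of)))
    have h' : f ⊙ₗₘ (δₗ S.toFunctor c₃ x.of ≫ (g ⊙ₗₘ h.of)) =
        c₁ ⊴ₗ δₗ S.toFunctor c₃ x.of ≫ (f ⊙ₗₘ g ⊙ₗₘ h.of) := by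
      rw [← id_actionHom, ← actionHom_comp, Category.id_comp]
    rw [cokleisliComp_eps, eps_cokleisliComp, h', Category.assoc, actionAssocIso_hom_naturality,
      δₗ_associativity_assoc]
  actionUnitIso_hom_naturality {x y} f := by
    apply Cokleisli.hom_ext
    change S.δ.app _ ≫ S.map (S.ε.app _ ≫ (λₗ[C] x.of).hom) ≫ f.of =
      S.δ.app _ ≫ S.map (δₗ S.toFunctor (𝟙_ C) x.of ≫ 𝟙_ C ⊴ₗ f.of) ≫
        S.ε.app _ ≫ (λₗ[C] y.of).hom
    rw [cokleisliComp_eps, eps_cokleisliComp, Category.assoc, ← actionUnitIso_hom_naturality,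
      ← Category.assoc, δₗ_unitality_hom]
  whiskerLeft_actionHomLeft c c' c'' f x := by
    change (Cokleisli.Adjunction.toCokleisli S).map ((c ◁ f) ⊵ₗ x.of) =
      (Cokleisli.Adjunction.toCokleisli S).map (αₗ c c' x.of).hom ≫
        cokleisliWhisker S c (S.ε.app (c' ⊙ₗ x.of) ≫ f ⊵ₗ x.of) ≫
        (Cokleisli.Adjunction.toCokleisli S).map (αₗ c c'' x.of).inv
    rw [cokleisliWhisker_toCokleisli, ← Functor.map_comp, ← Functor.map_comp,
      whiskerLeft_actionHomLeft]
  whiskerRight_actionHomLeft {c c'} c'' f x := by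
    change (Cokleisli.Adjunction.toCokleisli S).map ((f ▷ c'') ⊵ₗ x.of) =
      (Cokleisli.Adjunction.toCokleisli S).map (αₗ c c'' x.of).hom ≫
        (Cokleisli.Adjunction.toCokleisli S).map (f ⊵ₗ (c'' ⊙ₗ x.of)) ≫
        (Cokleisli.Adjunction.toCokleisli S).map (αₗ c' c'' x.of).inv
    rw [← Functor.map_comp, ← Functor.map_comp, whiskerRight_actionHomLeft]
  associator_actionHom c₁ c₂ c₃ x := by
    change (Cokleisli.Adjunction.toCokleisli S).map ((α_ c₁ c₂ c₃).hom ⊵ₗ x.of) ≫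
        (Cokleisli.Adjunction.toCokleisli S).map (αₗ c₁ (c₂ ⊗ c₃) x.of).hom ≫
        cokleisliWhisker S c₁ (S.ε.app ((c₂ ⊗ c₃) ⊙ₗ x.of) ≫ (αₗ c₂ c₃ x.of).hom) =
      (Cokleisli.Adjunction.toCokleisli S).map (αₗ (c₁ ⊗ c₂) c₃ x.of).hom ≫
        (Cokleisli.Adjunction.toCokleisli S).map (αₗ c₁ c₂ (c₃ ⊙ₗ x.of)).hom
    rw [cokleisliWhisker_toCokleisli, ← Functor.map_comp, ← Functor.map_comp, ← Functor.map_comp,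
      associator_actionHom]
  leftUnitor_actionHom c x := by
    change (Cokleisli.Adjunction.toCokleisli S).map ((λ_ c).hom ⊵ₗ x.of) =
      (Cokleisli.Adjunction.toCokleisli S).map (αₗ (𝟙_ C) c x.of).hom ≫
        (Cokleisli.Adjunction.toCokleisli S).map (λₗ (c ⊙ₗ x.of)).hom
    rw [← Functor.map_comp, leftUnitor_actionHom]
  rightUnitor_actionHom c x := by
    change (Cokleisli.Adjunction.toCokleisli S).map ((ρ_ c).hom ⊵ₗ x.of) =
      (Cokleisli.Adjunction.toCokleisli S).map (αₗ c (𝟙_ C) x.of).hom ≫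
        cokleisliWhisker S c (S.ε.app (𝟙_ C ⊙ₗ x.of) ≫ (λₗ[C] x.of).hom)
    rw [cokleisliWhisker_toCokleisli, ← Functor.map_comp, rightUnitor_actionHom]

/-- The embedding of the co-Kleisli category into the Eilenberg-Moore category of a comonad, onto
the cofree comodules. -/
def cokleisliToCoalgebra (S : Comonad D) : Cokleisli S ⥤ S.Coalgebra where
  obj x := S.cofree.obj x.of
  map {x y} f :=
    { f := S.δ.app x.of ≫ S.map f.of
      h := by
        change S.δ.app x.of ≫ S.map (S.δ.app x.of ≫ S.map f.of) =
          (S.δ.app x.of ≫ S.map f.of) ≫ S.δ.app y.of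
        have h := S.δ.naturality f.of
        simp only [Functor.comp_map] at h
        rw [S.map_comp, Category.assoc, h, ← Category.assoc, S.coassoc, Category.assoc] }
  map_id x := by
    apply Comonad.Coalgebra.Hom.ext
    exact S.right_counit x.of
  map_comp {x y z} f g := by
    apply Comonad.Coalgebra.Hom.ext
    change S.δ.app x.of ≫ S.map (S.δ.app x.of ≫ S.map f.of ≫ g.of) =
      (S.δ.app x.of ≫ S.map f.of) ≫ S.δ.app y.of ≫ S.map g.of
    have h := S.δ.naturality f.of
    simp only [Functor.comp_map] at h
    rw [S.map_comp, S.map_comp, Category.assoc, reassoc_of% h, ← Category.assoc, S.coassoc,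
      Category.assoc]

end Cokleisli

end Monads

/-! ### Linear structures on Eilenberg-Moore categories -/

section LinearStructures

variable {k : Type w} [CommRing k]

/-- Morphisms of algebras over a `k`-linear monad form `k`-modules. -/
instance algebraLinear {D : Type u₂} [Category.{v₂} D] [Preadditive D] [Linear k D] (T : Monad D)
    [T.toFunctor.Additive] [T.toFunctor.Linear k] : Linear k T.Algebra where
  homModule A B :=
    { smul r f :=
        { f := r • f.f
          h := by rw [T.toFunctor.map_smul, Linear.smul_comp, Linear.comp_smul, f.h] }
      one_smul f := Monad.Algebra.Hom.ext (one_smul k f.f)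
      mul_smul r s f := Monad.Algebra.Hom.ext (mul_smul r s f.f)
      smul_zero r := Monad.Algebra.Hom.ext (smul_zero r)
      smul_add r f g := Monad.Algebra.Hom.ext (smul_add r f.f g.f)
      add_smul r s f := Monad.Algebra.Hom.ext (add_smul r s f.f)
      zero_smul f := Monad.Algebra.Hom.ext (zero_smul k f.f) }
  smul_comp _ _ _ r f g := Monad.Algebra.Hom.ext (Linear.smul_comp _ _ _ r f.f g.f)
  comp_smul _ _ _ f r g := Monad.Algebra.Hom.ext (Linear.comp_smul _ _ _ f.f r g.f)

/-- Morphisms of comodules over a `k`-linear comonad form `k`-modules. -/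
instance coalgebraLinear {D : Type u₂} [Category.{v₂} D] [Preadditive D] [Linear k D]
    (S : Comonad D) [S.toFunctor.Additive] [S.toFunctor.Linear k] : Linear k S.Coalgebra where
  homModule A B :=
    { smul r f :=
        { f := r • f.f
          h := by rw [S.toFunctor.map_smul, Linear.smul_comp, Linear.comp_smul, f.h] }
      one_smul f := Comonad.Coalgebra.Hom.ext (one_smul k f.f)
      mul_smul r s f := Comonad.Coalgebra.Hom.ext (mul_smul r s f.f)
      smul_zero r := Comonad.Coalgebra.Hom.ext (smul_zero r)
      smul_add r f g := Comonad.Coalgebra.Hom.ext (smul_add r f.f g.f)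
      add_smul r s f := Comonad.Coalgebra.Hom.ext (add_smul r s f.f)
      zero_smul f := Comonad.Coalgebra.Hom.ext (zero_smul k f.f) }
  smul_comp _ _ _ r f g := Comonad.Coalgebra.Hom.ext (Linear.smul_comp _ _ _ r f.f g.f)
  comp_smul _ _ _ f r g := Comonad.Coalgebra.Hom.ext (Linear.comp_smul _ _ _ f.f r g.f)

variable {D : Type u₂} [Category.{v₂} D] [Preadditive D] {E : Type u} [Category.{v} E]
  [Preadditive E] {F : D ⥤ E} {U : E ⥤ D}

lemma rightAdjoint_linear [Linear k D] [Linear k E] (adj : F ⊣ U) [F.Linear k] : U.Linear k where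
  map_smul f r := by
    apply hom_ext_of_counitAt adj
    rw [F.map_smul, Linear.smul_comp, counitAt_naturality, counitAt_naturality, Linear.comp_smul]

lemma leftAdjoint_linear [Linear k D] [Linear k E] (adj : F ⊣ U) [U.Linear k] : F.Linear k where
  map_smul f r := by
    apply hom_ext_of_unitAt adj
    rw [U.map_smul, Linear.comp_smul, unitAt_naturality, unitAt_naturality, Linear.smul_comp]

instance toMonad_additive (adj : F ⊣ U) [F.Additive] : adj.toMonad.toFunctor.Additive :=
  haveI := adj.right_adjoint_additive
  inferInstanceAs (F ⋙ U).Additive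

instance toMonad_linear [Linear k D] [Linear k E] (adj : F ⊣ U) [F.Linear k] :
    adj.toMonad.toFunctor.Linear k :=
  haveI : U.Linear k := rightAdjoint_linear adj
  inferInstanceAs ((F ⋙ U).Linear k)

instance toComonad_additive (adj : F ⊣ U) [U.Additive] : adj.toComonad.toFunctor.Additive :=
  haveI := adj.left_adjoint_additive
  inferInstanceAs (U ⋙ F).Additive

instance toComonad_linear [Linear k D] [Linear k E] (adj : F ⊣ U) [U.Linear k] :
    adj.toComonad.toFunctor.Linear k :=
  haveI : F.Linear k := leftAdjoint_linear adj
  inferInstanceAs ((U ⋙ F).Linear k)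

end LinearStructures

/-! ### Actions on Eilenberg-Moore categories -/

section EilenbergMooreActions

variable (C : Type u₁) [Category.{v₁} C] [MonoidalCategory C]
  {D : Type u₂} [Category.{v₂} D] [MonoidalLeftAction C D]

open Functor.LaxLeftLinear Functor.OplaxLeftLinear

/-- The action of `C` on `T`-modules extends the action on the Kleisli category: the canonical
functor from the Kleisli category admits the structure of a strong `C`-module functor. -/
def IsExtendedAction (T : Monad D) [LaxModuleMonad C T] [MonoidalLeftAction C T.Algebra] : Prop :=
  Nonempty ((kleisliToAlgebra T).LeftLinear C)

/-- The dual of `IsExtendedAction`. -/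
def IsExtendedCoaction (S : Comonad D) [OplaxModuleComonad C S]
    [MonoidalLeftAction C S.Coalgebra] : Prop :=
  Nonempty ((cokleisliToCoalgebra S).LeftLinear C)

section Linton

variable {C} (T : Monad D) [LaxModuleMonad C T]

/-- `T (c ▷ a) : T (c ▷ T A) ⟶ T (c ▷ A)` for a `T`-module `(A, a)`. -/
def lintonLeft (c : C) (A : T.Algebra) :
    T.free.obj (c ⊙ₗ T.obj A.A) ⟶ T.free.obj (c ⊙ₗ A.A) :=
  T.free.map (c ⊴ₗ A.a)

/-- The composite `T (c ▷ T A) ⟶ T T (c ▷ A) ⟶ T (c ▷ A)` of the image under `T` of the coherence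
of `T` with the multiplication. -/
def lintonRight (c : C) (A : T.Algebra) :
    T.free.obj (c ⊙ₗ T.obj A.A) ⟶ T.free.obj (c ⊙ₗ A.A) :=
  (kleisliToAlgebra T).map (X := Kleisli.mk T (c ⊙ₗ T.obj A.A)) (Y := Kleisli.mk T (c ⊙ₗ A.A))
    (Kleisli.Hom.mk (μₗ T.toFunctor c A.A))

/-- The morphism of `T`-modules `T (c ▷ A) ⟶ B` extending `u : c ▷ A ⟶ B`. -/
def lintonDesc (c : C) (A B : T.Algebra) (u : c ⊙ₗ A.A ⟶ B.A) : T.free.obj (c ⊙ₗ A.A) ⟶ B where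
  f := T.map u ≫ B.a
  h := by
    change T.map (T.map u ≫ B.a) ≫ B.a = T.μ.app _ ≫ T.map u ≫ B.a
    have h := T.μ.naturality u
    simp only [Functor.comp_map] at h
    rw [T.map_comp, Category.assoc, ← B.assoc, ← reassoc_of% h]

variable (C)

/-- The action of `C` on `T`-modules is the one given by Linton coequalizers: for all `c` and
`(A, a)`, the universal map exhibits `c ▶ A` as the coequalizer of `T (c ▷ T A) ⇉ T (c ▷ A)`. The
maps `c ▷ A ⟶ c ▶ A` that correspond to the quotient maps are required to be a lax `C`-module
structure on the forgetful functor, which says that the value of `▶` on morphisms, its associator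
and its unitor are the ones induced from `D` on coequalizers. These data determine the action up to a
unique isomorphism compatible with the quotient maps. -/
def IsLintonAction [MonoidalLeftAction C T.Algebra] : Prop :=
  ∃ _ : T.forget.LaxLeftLinear C, ∀ (c : C) (A : T.Algebra),
    ∃ w : lintonLeft T c A ≫ lintonDesc T c A (c ⊙ₗ A) (μₗ T.forget c A) =
        lintonRight T c A ≫ lintonDesc T c A (c ⊙ₗ A) (μₗ T.forget c A),
      Nonempty (IsColimit (Cofork.ofπ (lintonDesc T c A (c ⊙ₗ A) (μₗ T.forget c A)) w))

end Linton

section Colinton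

variable {C} (S : Comonad D) [OplaxModuleComonad C S]

/-- `S (c ▷ a) : S (c ▷ A) ⟶ S (c ▷ S A)` for an `S`-comodule `(A, a)`. -/
def colintonLeft (c : C) (A : S.Coalgebra) :
    S.cofree.obj (c ⊙ₗ A.A) ⟶ S.cofree.obj (c ⊙ₗ S.obj A.A) :=
  S.cofree.map (c ⊴ₗ A.a)

/-- The composite `S (c ▷ A) ⟶ S S (c ▷ A) ⟶ S (c ▷ S A)` of the comultiplication with the image
under `S` of the coherence of `S`. -/
def colintonRight (c : C) (A : S.Coalgebra) :
    S.cofree.obj (c ⊙ₗ A.A) ⟶ S.cofree.obj (c ⊙ₗ S.obj A.A) :=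
  (cokleisliToCoalgebra S).map (X := Cokleisli.mk S (c ⊙ₗ A.A))
    (Y := Cokleisli.mk S (c ⊙ₗ S.obj A.A)) (Cokleisli.Hom.mk (δₗ S.toFunctor c A.A))

/-- The morphism of `S`-comodules `B ⟶ S (c ▷ A)` that corresponds to `u : B ⟶ c ▷ A`. -/
def colintonLift (c : C) (A B : S.Coalgebra) (u : B.A ⟶ c ⊙ₗ A.A) :
    B ⟶ S.cofree.obj (c ⊙ₗ A.A) where
  f := B.a ≫ S.map u
  h := by
    change B.a ≫ S.map (B.a ≫ S.map u) = (B.a ≫ S.map u) ≫ S.δ.app _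
    have h := S.δ.naturality u
    simp only [Functor.comp_map] at h
    rw [S.map_comp, Category.assoc, h, ← Category.assoc, ← Category.assoc, B.coassoc]

variable (C)

/-- The dual of `IsLintonAction`: for all `c` and `(A, a)`, the universal map exhibits `c ▶ A` as the
equalizer of `S (c ▷ A) ⇉ S (c ▷ S A)`, compatibly with the structure of `▶`. -/
def IsColintonAction [MonoidalLeftAction C S.Coalgebra] : Prop :=
  ∃ _ : S.forget.OplaxLeftLinear C, ∀ (c : C) (A : S.Coalgebra),
    ∃ w : colintonLift S c A (c ⊙ₗ A) (δₗ S.forget c A) ≫ colintonLeft S c A =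
        colintonLift S c A (c ⊙ₗ A) (δₗ S.forget c A) ≫ colintonRight S c A,
      Nonempty (IsLimit (Fork.ofι (colintonLift S c A (c ⊙ₗ A) (δₗ S.forget c A)) w))

end Colinton

/-! ### Projective and injective objects relative to an action -/

/-- `X` is `C`-projective. -/
def IsCProjective (X : D) : Prop :=
  ∀ P : C, Projective P → Projective (P ⊙ₗ X)

/-- `X` is a `C`-generator: every projective object is a direct summand of some `P ▷ X` with `P`
projective. -/
def IsCGenerator (X : D) : Prop :=
  ∀ Q : D, Projective Q → ∃ P : C, Projective P ∧ Nonempty (Retract Q (P ⊙ₗ X))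

/-- `X` is `C`-injective. -/
def IsCInjective (X : D) : Prop :=
  ∀ I : C, Injective I → Injective (I ⊙ₗ X)

/-- `X` is a `C`-cogenerator: every injective object is a direct summand of some `I ▷ X` with `I`
injective. -/
def IsCCogenerator (X : D) : Prop :=
  ∀ Q : D, Injective Q → ∃ I : C, Injective I ∧ Nonempty (Retract Q (I ⊙ₗ X))

end EilenbergMooreActions

end ModuleReconstruction

/-! The functor `- ▷ X` is strong, so its right adjoint `H = [X,-]` is a lax module functor and `T =
H (- ▷ X)` is a lax module monad. Everything rests on showing that `H` is monadic.

Being a right adjoint, `H` is left exact. Since `P ▷ X` is projective for projective `P`, a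
projective cover of `H B` factors through `H f` whenever `f : A ⟶ B` is epi, so `H` preserves
epimorphisms and is exact (`IsCProjective.preservesEpimorphisms`). Since the projectives of `M` are
summands of objects `P ▷ X`, and maps out of these are detected by `H`, it is also faithful
(`IsCGenerator.faithful`). An exact faithful right adjoint between abelian categories is monadic:
fullness of the comparison functor follows by descending along the counit, which is epi
(`exists_map_eq_of_faithful`), and essential surjectivity follows because `H` preserves the
coequalizer that presents a module by free ones (`exists_iso_comparison`).

The action on `EM(T)` is the one transported from `M` along this equivalence, so bilinearity and
strength of the comparison functor are formal (`transportAction`, `transportLeftLinear`). It is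
extended because the Kleisli embedding factors as the functor `x ↦ x ▷ X` from the Kleisli category
to `M` followed by the comparison functor, and whiskering of Kleisli morphisms transposes to the
action on `M` (`actionHomRight_transpose_comp_lineator`).

Finally, each module is canonically a coequalizer of free modules. For an extended action, `c ▶ -`
sends the parallel pair of this presentation to the Linton pair up to isomorphism. If `c ▶ -` is
right exact the coequalizer is preserved, and right exactness passes from `c ▷ -` on `M` to `c ▶ -`.
The second half is dual: `⟨X,-⟩` is right exact as a left adjoint, preserves monomorphisms and is
faithful, hence is comonadic. -/

namespace ModuleReconstruction

open Functor.LaxLeftLinear Functor.OplaxLeftLinear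

/-! ### Strong module functors -/

section Strong

variable {C : Type u₁} [Category.{v₁} C] [MonoidalCategory C]
  {D : Type u₂} [Category.{v₂} D] [MonoidalLeftAction C D]
  {E : Type u} [Category.{v} E] [MonoidalLeftAction C E]

/-- A lax `C`-module functor with invertible coherence morphisms is strong. -/
@[reducible]
noncomputable def leftLinearOfLax (F : D ⥤ E) [F.LaxLeftLinear C]
    [∀ (c : C) (d : D), IsIso (μₗ F c d)] : F.LeftLinear C where
  δₗ c d := inv (μₗ F c d)
  δₗ_naturality_left f d := by
    rw [IsIso.comp_inv_eq, Category.assoc, μₗ_naturality_left, IsIso.inv_hom_id_assoc]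
  δₗ_naturality_right c _ _ f := by
    rw [IsIso.comp_inv_eq, Category.assoc, μₗ_naturality_right, IsIso.inv_hom_id_assoc]
  δₗ_associativity c c' d := by
    rw [IsIso.inv_comp_eq, μₗ_associativity_assoc, IsIso.hom_inv_id_assoc,
      ← actionHomRight_comp, IsIso.hom_inv_id, actionHomRight_id, Category.comp_id]
  δₗ_unitality_inv d := by
    rw [IsIso.eq_comp_inv, μₗ_unitality_inv]
  μₗ_comp_δₗ c d := IsIso.hom_inv_id _
  δₗ_comp_μₗ c d := IsIso.inv_hom_id _

/-- An oplax `C`-module functor with invertible coherence morphisms is strong. -/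
@[reducible]
noncomputable def leftLinearOfOplax (F : D ⥤ E) [F.OplaxLeftLinear C]
    [∀ (c : C) (d : D), IsIso (δₗ F c d)] : F.LeftLinear C where
  μₗ c d := inv (δₗ F c d)
  μₗ_naturality_left f d := by
    rw [IsIso.comp_inv_eq, Category.assoc, δₗ_naturality_left, IsIso.inv_hom_id_assoc]
  μₗ_naturality_right c _ _ f := by
    rw [IsIso.comp_inv_eq, Category.assoc, δₗ_naturality_right, IsIso.inv_hom_id_assoc]
  μₗ_associativity c c' d := by
    rw [IsIso.inv_comp_eq, δₗ_associativity_assoc, actionHomRight_hom_inv'_assoc, IsIso.hom_inv_id,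
      Category.comp_id]
  μₗ_unitality d := by
    rw [IsIso.eq_inv_comp, δₗ_unitality_hom]
  μₗ_comp_δₗ c d := IsIso.inv_hom_id _
  δₗ_comp_μₗ c d := IsIso.hom_inv_id _

/-- The composite of two strong `C`-module functors. -/
@[reducible]
def compLeftLinear {E' : Type*} [Category* E'] [MonoidalLeftAction C E'] (F : D ⥤ E) (G : E ⥤ E')
    [F.LeftLinear C] [G.LeftLinear C] : (F ⋙ G).LeftLinear C where
  μₗ c d := μₗ G c (F.obj d) ≫ G.map (μₗ F c d)
  μₗ_naturality_left f d := by
    simp [← Functor.map_comp]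
  μₗ_naturality_right c d d' f := by
    simp [← Functor.map_comp]
  μₗ_associativity c c' d := by
    have h := congr_arg G.map (μₗ_associativity F c c' d)
    simp only [Functor.map_comp] at h
    simp only [Functor.comp_obj, Functor.comp_map, Category.assoc, actionHomRight_comp]
    rw [h, μₗ_associativity_assoc, μₗ_naturality_right_assoc]
  μₗ_unitality d := by
    simp [← Functor.map_comp]
  δₗ c d := G.map (δₗ F c d) ≫ δₗ G c (F.obj d)
  δₗ_naturality_left {c c'} f d := by
    simp only [Functor.comp_obj, Functor.comp_map, Category.assoc]
    rw [← δₗ_naturality_left G, ← Category.assoc, ← G.map_comp, δₗ_naturality_left, G.map_comp,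
      Category.assoc]
  δₗ_naturality_right c d d' f := by
    simp only [Functor.comp_obj, Functor.comp_map, Category.assoc]
    rw [← δₗ_naturality_right G, ← Category.assoc, ← G.map_comp, δₗ_naturality_right, G.map_comp,
      Category.assoc]
  δₗ_associativity c c' d := by
    have h := congr_arg G.map (δₗ_associativity F c c' d)
    simp only [Functor.map_comp] at h
    simp only [Functor.comp_obj, Functor.comp_map, Category.assoc, actionHomRight_comp]
    rw [δₗ_associativity, reassoc_of% h, δₗ_naturality_right_assoc]
  δₗ_unitality_inv d := by
    have h := congr_arg G.map (δₗ_unitality_inv F (C := C) d)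
    simp only [Functor.map_comp] at h
    simp only [Functor.comp_obj, Functor.comp_map]
    rw [δₗ_unitality_inv, h, Category.assoc]
  μₗ_comp_δₗ c d := by
    simp [← Functor.map_comp_assoc]
  δₗ_comp_μₗ c d := by
    simp [← Functor.map_comp]

end Strong

/-! ### Transport of an action along an equivalence -/

section Transport

variable {C : Type u₁} [Category.{v₁} C] [MonoidalCategory C]
  {D : Type u₂} [Category.{v₂} D] [MonoidalLeftAction C D]
  {E : Type u} [Category.{v} E] (e : D ≌ E)

instance isIso_unitAt (d : D) : IsIso (unitAt e.toAdjunction d) :=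
  inferInstanceAs (IsIso (e.unit.app d))

instance isIso_counitAt (x : E) : IsIso (counitAt e.toAdjunction x) :=
  inferInstanceAs (IsIso (e.counit.app x))

/-- The action of `C` on `E` that corresponds to an action on `D` under an equivalence `D ≌ E`. -/
@[reducible]
noncomputable def transportAction : MonoidalLeftAction C E where
  actionObj c x := e.functor.obj (c ⊙ₗ e.inverse.obj x)
  actionHomLeft f x := e.functor.map (f ⊵ₗ e.inverse.obj x)
  actionHomRight c _ _ f := e.functor.map (c ⊴ₗ e.inverse.map f)
  actionHom f g := e.functor.map (f ⊙ₗₘ e.inverse.map g)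
  -- Acting twice inserts `e.inverse` after `e.functor` between the two actions; the unit accounts
  -- for this composite in the associator, and the counit does so for the unitor.
  actionAssocIso c c' x := e.functor.mapIso (αₗ c c' (e.inverse.obj x) ≪≫
    asIso (c ⊴ₗ unitAt e.toAdjunction (c' ⊙ₗ e.inverse.obj x)))
  actionUnitIso x :=
    e.functor.mapIso (λₗ (e.inverse.obj x)) ≪≫ asIso (counitAt e.toAdjunction x)
  actionHom_def f g := by
    rw [actionHom_def, Functor.map_comp]
  actionHomRight_id c x := by
    rw [e.inverse.map_id, actionHomRight_id, e.functor.map_id]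
  id_actionHomLeft c x := by
    rw [id_actionHomLeft, e.functor.map_id]
  actionHom_comp f₁ f₂ g₁ g₂ := by
    rw [Functor.map_comp, actionHom_comp, Functor.map_comp]
  actionAssocIso_hom_naturality {c₁ c₂ c₃ c₄ x y} f g h := by
    change e.functor.map ((f ⊗ₘ g) ⊙ₗₘ e.inverse.map h) ≫
        e.functor.map ((αₗ c₂ c₄ _).hom ≫ c₂ ⊴ₗ unitAt e.toAdjunction _) =
      e.functor.map ((αₗ c₁ c₃ _).hom ≫ c₁ ⊴ₗ unitAt e.toAdjunction _) ≫
        e.functor.map (f ⊙ₗₘ e.inverse.map (e.functor.map (g ⊙ₗₘ e.inverse.map h)))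
    rw [← Functor.map_comp, ← Functor.map_comp, actionAssocIso_hom_naturality_assoc,
      Category.assoc, actionHom_def' f, actionHom_def' f, Category.assoc, ← action_exchange,
      ← actionHomRight_comp_assoc, ← actionHomRight_comp_assoc, unitAt_naturality]
  actionUnitIso_hom_naturality {x y} f := by
    change (e.functor.map (λₗ[C] (e.inverse.obj x)).hom ≫ counitAt e.toAdjunction x) ≫ f =
      e.functor.map (𝟙_ C ⊴ₗ e.inverse.map f) ≫
        e.functor.map (λₗ[C] (e.inverse.obj y)).hom ≫ counitAt e.toAdjunction y
    rw [← Functor.map_comp_assoc, ← actionUnitIso_hom_naturality, Functor.map_comp_assoc,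
      Category.assoc, counitAt_naturality]
  whiskerLeft_actionHomLeft c c' c'' f x := by
    change e.functor.map ((c ◁ f) ⊵ₗ e.inverse.obj x) =
      e.functor.map ((αₗ c c' _).hom ≫ c ⊴ₗ unitAt e.toAdjunction _) ≫
        e.functor.map (c ⊴ₗ e.inverse.map (e.functor.map (f ⊵ₗ e.inverse.obj x))) ≫
          e.functor.map (inv (c ⊴ₗ unitAt e.toAdjunction _) ≫ (αₗ c c'' _).inv)
    rw [← Functor.map_comp, ← Functor.map_comp, Category.assoc, ← actionHomRight_comp_assoc,
      unitAt_naturality, actionHomRight_comp_assoc, IsIso.hom_inv_id_assoc,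
      whiskerLeft_actionHomLeft]
  whiskerRight_actionHomLeft {c c'} c'' f x := by
    change e.functor.map ((f ▷ c'') ⊵ₗ e.inverse.obj x) =
      e.functor.map ((αₗ c c'' _).hom ≫ c ⊴ₗ unitAt e.toAdjunction _) ≫
        e.functor.map (f ⊵ₗ e.inverse.obj (e.functor.obj (c'' ⊙ₗ e.inverse.obj x))) ≫
          e.functor.map (inv (c' ⊴ₗ unitAt e.toAdjunction _) ≫ (αₗ c' c'' _).inv)
    rw [← Functor.map_comp, ← Functor.map_comp, Category.assoc, action_exchange_assoc,
      IsIso.hom_inv_id_assoc, whiskerRight_actionHomLeft]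
  associator_actionHom c₁ c₂ c₃ x := by
    change e.functor.map ((α_ c₁ c₂ c₃).hom ⊵ₗ e.inverse.obj x) ≫
        e.functor.map ((αₗ c₁ (c₂ ⊗ c₃) _).hom ≫ c₁ ⊴ₗ unitAt e.toAdjunction _) ≫
        e.functor.map (c₁ ⊴ₗ e.inverse.map (e.functor.map
          ((αₗ c₂ c₃ _).hom ≫ c₂ ⊴ₗ unitAt e.toAdjunction _))) =
      e.functor.map ((αₗ (c₁ ⊗ c₂) c₃ _).hom ≫ (c₁ ⊗ c₂) ⊴ₗ unitAt e.toAdjunction _) ≫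
        e.functor.map ((αₗ c₁ c₂ _).hom ≫ c₁ ⊴ₗ unitAt e.toAdjunction _)
    simp only [← Functor.map_comp]
    congr 1
    rw [Category.assoc, ← actionHomRight_comp, unitAt_naturality]
    simp
  -- The two unit laws use one triangle identity each: this one the triangle at `e.functor`, the
  -- next one the triangle at `e.inverse`.
  leftUnitor_actionHom c x := by
    change e.functor.map ((λ_ c).hom ⊵ₗ e.inverse.obj x) =
      e.functor.map ((αₗ (𝟙_ C) c _).hom ≫ 𝟙_ C ⊴ₗ unitAt e.toAdjunction _) ≫
        e.functor.map (λₗ[C] _).hom ≫ counitAt e.toAdjunction _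
    rw [← Functor.map_comp_assoc, Category.assoc, ← actionUnitIso_hom_naturality,
      ← leftUnitor_actionHom_assoc, Functor.map_comp_assoc, map_unitAt_comp_counitAt,
      Category.comp_id]
  rightUnitor_actionHom c x := by
    change e.functor.map ((ρ_ c).hom ⊵ₗ e.inverse.obj x) =
      e.functor.map ((αₗ c (𝟙_ C) _).hom ≫ c ⊴ₗ unitAt e.toAdjunction _) ≫
        e.functor.map (c ⊴ₗ e.inverse.map
          (e.functor.map (λₗ[C] _).hom ≫ counitAt e.toAdjunction _))
    rw [← Functor.map_comp, Category.assoc, ← actionHomRight_comp, Functor.map_comp e.inverse,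
      ← Category.assoc (unitAt _ _), unitAt_naturality, Category.assoc, unitAt_comp_map_counitAt,
      Category.comp_id, rightUnitor_actionHom]

/-- The equivalence is a strong `C`-module functor for the transported action. -/
@[reducible]
noncomputable def transportLeftLinear :
    letI := transportAction (C := C) e
    e.functor.LeftLinear C :=
  letI := transportAction (C := C) e
  letI : e.functor.LaxLeftLinear C :=
    -- The transported `c ▶ e d` is `e (c ▷ e⁻¹ e d)`, so inverting the unit at `d` yields the
    -- coherence.
    { μₗ c d := e.functor.map (c ⊴ₗ inv (unitAt e.toAdjunction d))
      μₗ_naturality_left f d := by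
        change e.functor.map (f ⊵ₗ e.inverse.obj (e.functor.obj d)) ≫
            e.functor.map (_ ⊴ₗ inv (unitAt e.toAdjunction d)) =
          e.functor.map (_ ⊴ₗ inv (unitAt e.toAdjunction d)) ≫ e.functor.map (f ⊵ₗ d)
        rw [← Functor.map_comp, ← Functor.map_comp, ← action_exchange]
      μₗ_naturality_right c {d d'} f := by
        change e.functor.map (c ⊴ₗ e.inverse.map (e.functor.map f)) ≫
            e.functor.map (c ⊴ₗ inv (unitAt e.toAdjunction d')) =
          e.functor.map (c ⊴ₗ inv (unitAt e.toAdjunction d)) ≫ e.functor.map (c ⊴ₗ f)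
        rw [← Functor.map_comp, ← Functor.map_comp, ← actionHomRight_comp, ← actionHomRight_comp]
        congr 2
        rw [IsIso.comp_inv_eq, Category.assoc, IsIso.eq_inv_comp, unitAt_naturality]
      μₗ_associativity c c' d := by
        change e.functor.map ((c ⊗ c') ⊴ₗ inv (unitAt e.toAdjunction d)) ≫
            e.functor.map (αₗ c c' d).hom =
          e.functor.map ((αₗ c c' _).hom ≫ c ⊴ₗ unitAt e.toAdjunction _) ≫
            e.functor.map (c ⊴ₗ e.inverse.map
              (e.functor.map (c' ⊴ₗ inv (unitAt e.toAdjunction d)))) ≫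
              e.functor.map (c ⊴ₗ inv (unitAt e.toAdjunction _))
        simp only [← Functor.map_comp]
        congr 1
        rw [Category.assoc, ← actionHomRight_comp, ← actionHomRight_comp, ← Category.assoc
          (unitAt _ _), unitAt_naturality, Category.assoc, IsIso.hom_inv_id, Category.comp_id,
          tensor_actionHomRight, Category.assoc, Category.assoc, Iso.inv_hom_id, Category.comp_id]
      μₗ_unitality d := by
        change e.functor.map (λₗ[C] _).hom ≫ counitAt e.toAdjunction _ =
          e.functor.map (𝟙_ C ⊴ₗ inv (unitAt e.toAdjunction d)) ≫ e.functor.map (λₗ[C] d).hom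
        rw [← Functor.map_comp, ← actionUnitIso_hom_naturality, Functor.map_comp, Functor.map_inv]
        congr 1
        exact IsIso.eq_inv_of_hom_inv_id (map_unitAt_comp_counitAt _ d) }
  haveI (c : C) (d : D) : IsIso (μₗ e.functor c d) :=
    inferInstanceAs (IsIso (e.functor.map (c ⊴ₗ inv (unitAt e.toAdjunction d))))
  leftLinearOfLax e.functor

/-- By definition the transported `c ▶ -` is `c ▷ -` conjugated by the equivalence, and equivalences
preserve colimits. -/
lemma transport_preservesFiniteColimits (c : C) [PreservesFiniteColimits (actionLeft D c)] :
    letI := transportAction (C := C) e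
    PreservesFiniteColimits (actionLeft E c) :=
  inferInstanceAs (PreservesFiniteColimits (e.inverse ⋙ actionLeft D c ⋙ e.functor))

lemma transport_preservesFiniteLimits (c : C) [PreservesFiniteLimits (actionLeft D c)] :
    letI := transportAction (C := C) e
    PreservesFiniteLimits (actionLeft E c) :=
  inferInstanceAs (PreservesFiniteLimits (e.inverse ⋙ actionLeft D c ⋙ e.functor))

/-- The inverse of a `k`-linear equivalence is again additive and `k`-linear, so conjugation by it
keeps bilinearity. -/
lemma transport_linear (k : Type w) [CommRing k] [Preadditive C] [Linear k C] [Preadditive D]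
    [Linear k D] [Preadditive E] [Linear k E] [LinearLeftAction k C D] [e.functor.Additive]
    [e.functor.Linear k] :
    letI := transportAction (C := C) e
    LinearLeftAction k C E :=
  letI := transportAction (C := C) e
  haveI : PreadditiveLeftAction C D := LinearLeftAction.toPreadditiveLeftAction k
  { add_homLeft f g x := by
      change e.functor.map ((f + g) ⊵ₗ _) = e.functor.map (f ⊵ₗ _) + e.functor.map (g ⊵ₗ _)
      rw [PreadditiveLeftAction.add_homLeft, Functor.map_add]
    homRight_add c _ _ f g := by
      change e.functor.map (c ⊴ₗ e.inverse.map (f + g)) =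
        e.functor.map (c ⊴ₗ e.inverse.map f) + e.functor.map (c ⊴ₗ e.inverse.map g)
      rw [Functor.map_add, PreadditiveLeftAction.homRight_add, Functor.map_add]
    smul_homLeft r _ _ f x := by
      change e.functor.map ((r • f) ⊵ₗ _) = r • e.functor.map (f ⊵ₗ _)
      rw [LinearLeftAction.smul_homLeft, Functor.map_smul]
    homRight_smul r c _ _ f := by
      change e.functor.map (c ⊴ₗ e.inverse.map (r • f)) =
        r • e.functor.map (c ⊴ₗ e.inverse.map f)
      rw [Functor.map_smul, LinearLeftAction.homRight_smul, Functor.map_smul] }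

end Transport

/-! ### Exact faithful right adjoints are monadic -/

section Monadicity

variable {C : Type u₁} [Category.{v₁} C] {M : Type u₂} [Category.{v₂} M]

/-- By the triangle identity the unit is a section. -/
lemma epi_map_counitAt {F : C ⥤ M} {H : M ⥤ C} (adj : F ⊣ H) (B : M) :
    Epi (H.map (counitAt adj B)) :=
  epi_of_epi_fac (unitAt_comp_map_counitAt adj B)

/-- Essential surjectivity, by Beck's argument. The preimage of `(A, a)` is the coequalizer in `M`
of the pair `F a`, `ε_{F A}`; `H` preserves it, and the `H`-image of this pair already has `a` as
its coequalizer. -/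
lemma exists_iso_comparison [Abelian M] {F : C ⥤ M} {H : M ⥤ C} (adj : F ⊣ H)
    [PreservesFiniteColimits H] (A : adj.toMonad.Algebra) :
    ∃ B : M, Nonempty ((Monad.comparison adj).obj B ≅ A) := by
  let a : H.obj (F.obj A.A) ⟶ A.A := A.a
  have ha : H.map (F.map a) ≫ a = H.map (counitAt adj (F.obj A.A)) ≫ a := A.assoc.symm
  have hu : unitAt adj A.A ≫ a = 𝟙 _ := A.unit
  -- The unit law splits `a`, so every functor sends `a` to an epimorphism. This is what later makes
  -- `H F H π` epi, since `H π` is `a` up to the isomorphism `i`.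
  have : Epi (H.map (F.map a)) :=
    epi_of_epi_fac (f := H.map (F.map (unitAt adj A.A))) (h := 𝟙 _)
      (by rw [← Functor.map_comp, ← Functor.map_comp, hu, F.map_id, H.map_id])
  let π := coequalizer.π (F.map a) (counitAt adj (F.obj A.A))
  have hπ : H.map (F.map a) ≫ H.map π = H.map (counitAt adj (F.obj A.A)) ≫ H.map π := by
    rw [← Functor.map_comp, coequalizer.condition, Functor.map_comp]
  have hA : IsColimit (Cofork.ofπ a ha) := Monad.beckCoequalizer A
  have hB : IsColimit (Cofork.ofπ (H.map π) hπ) :=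
    isColimitCoforkMapOfIsColimit H _ (coequalizerIsCoequalizer _ _)
  let i : H.obj (coequalizer (F.map a) (counitAt adj (F.obj A.A))) ≅ A.A :=
    hB.coconePointUniqueUpToIso hA
  have hi : H.map π ≫ i.hom = a :=
    hB.comp_coconePointUniqueUpToIso_hom hA WalkingParallelPair.one
  refine ⟨_, ⟨Monad.Algebra.isoMk i ?_⟩⟩
  -- Compatibility of `i` with the module structures is checked after precomposing with the
  -- epimorphism `H F H π`, where it becomes the associativity law `ha` of `a`.
  change H.map (F.map i.hom) ≫ a = H.map (counitAt adj _) ≫ i.hom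
  have : Epi (H.map (F.map (H.map π))) := by
    rw [(Iso.eq_comp_inv i).2 hi, Functor.map_comp, Functor.map_comp]
    infer_instance
  rw [← cancel_epi (H.map (F.map (H.map π))), ← Functor.map_comp_assoc, ← Functor.map_comp, hi, ha,
    ← Functor.map_comp_assoc, counitAt_naturality, Functor.map_comp_assoc, hi]

variable [Abelian C] [Abelian M]

/-- Right exactness is tested on short exact sequences: left exactness gives exactness in the
middle, so only the epimorphism at the end is missing. -/
lemma preservesFiniteColimits_of_preservesEpimorphisms (H : M ⥤ C) [H.Additive]
    [PreservesFiniteLimits H] [H.PreservesEpimorphisms] : PreservesFiniteColimits H := by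
  rw [Functor.preservesFiniteColimits_iff_forall_exact_map_and_epi]
  intro S hS
  have := hS.epi_g
  exact ⟨((Functor.preservesFiniteLimits_iff_forall_exact_map_and_mono H).1 ‹_› S hS).1,
    inferInstanceAs (Epi (H.map S.g))⟩

lemma preservesFiniteLimits_of_preservesMonomorphisms (H : M ⥤ C) [H.Additive]
    [PreservesFiniteColimits H] [H.PreservesMonomorphisms] : PreservesFiniteLimits H := by
  rw [Functor.preservesFiniteLimits_iff_forall_exact_map_and_mono]
  intro S hS
  have := hS.mono_f
  exact ⟨((Functor.preservesFiniteColimits_iff_forall_exact_map_and_epi H).1 ‹_› S hS).1,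
    inferInstanceAs (Mono (H.map S.f))⟩

section RightAdjoint

variable {F : C ⥤ M} {H : M ⥤ C} (adj : F ⊣ H)

include adj

/-- Fullness of the comparison functor. A faithful `H` reflects epimorphisms, so the counit at `A`
is epi and hence the cokernel of its kernel. The transpose `F g ≫ ε_B` kills that kernel, as one
sees after applying `H` and using that `g` is a module morphism; it therefore descends to `A ⟶ B`.
-/
lemma exists_map_eq_of_faithful [H.Faithful] [H.PreservesZeroMorphisms] {A B : M}
    (g : H.obj A ⟶ H.obj B)
    (hg : H.map (F.map g) ≫ H.map (counitAt adj B) = H.map (counitAt adj A) ≫ g) :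
    ∃ f : A ⟶ B, H.map f = g := by
  have := epi_map_counitAt adj A
  have : Epi (counitAt adj A) := H.epi_of_epi_map this
  have h : kernel.ι (counitAt adj A) ≫ F.map g ≫ counitAt adj B = 0 := by
    apply H.map_injective
    rw [Functor.map_comp, Functor.map_comp, hg, ← Functor.map_comp_assoc, kernel.condition,
      Functor.map_zero, Functor.map_zero, zero_comp]
  refine ⟨Abelian.epiDesc (counitAt adj A) _ h, ?_⟩
  rw [← cancel_epi (H.map (counitAt adj A)), ← Functor.map_comp, Abelian.comp_epiDesc,
    Functor.map_comp, hg]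

/-- Faithfulness of the comparison functor is inherited from `H` by instance search, which leaves
fullness and essential surjectivity. -/
theorem isEquivalence_comparison_of_faithful [H.Additive] [H.Faithful]
    [PreservesFiniteColimits H] : (Monad.comparison adj).IsEquivalence where
  full := ⟨fun {A B} g => by
    obtain ⟨f, hf⟩ := exists_map_eq_of_faithful adj g.f g.h
    exact ⟨f, Monad.Algebra.Hom.ext hf⟩⟩
  essSurj := ⟨fun A => by
    obtain ⟨B, hB⟩ := exists_iso_comparison adj A
    exact ⟨B, hB⟩⟩

end RightAdjoint

end Monadicity

/-! ### Exactness of internal homs -/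

section Closed

variable {C : Type u₁} [Category.{v₁} C] [MonoidalCategory C]
  {M : Type u₂} [Category.{v₂} M] [MonoidalLeftAction C M] {X : M}
  {H : M ⥤ C} (adj : actionRight (C := C) X ⊣ H)

include adj

/-- For `P` a projective cover of `H B`, the transpose `P ▷ X ⟶ B` of the covering map lifts along
`f` because `P ▷ X` is projective. Transposing the lift back factors the epimorphism `P ⟶ H B`
through `H f`. -/
lemma IsCProjective.preservesEpimorphisms [EnoughProjectives C] (hX : IsCProjective C X) :
    H.PreservesEpimorphisms where
  preserves {A B} f _ := by
    have : Projective ((actionRight (C := C) X).obj (Projective.over (H.obj B))) := hX _ inferInstance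
    have h : adj.homEquiv _ _
        (Projective.factorThru ((adj.homEquiv _ _).symm (Projective.π (H.obj B))) f) ≫ H.map f =
          Projective.π (H.obj B) := by
      rw [← adj.homEquiv_naturality_right, Projective.factorThru_comp, Equiv.apply_symm_apply]
    exact epi_of_epi_fac h

/-- By the adjunction, `H f = H g` forces `f` and `g` to agree after any map from an object `P ▷ X`.
A projective cover of `A` is a retract of such an object, so the cover extends to it and then
cancels. -/
lemma IsCGenerator.faithful [EnoughProjectives M] (hX : IsCGenerator C X) :
    H.Faithful where
  map_injective {A B f g} hfg := by
    obtain ⟨P, -, ⟨(r : Retract (Projective.over A) ((actionRight (C := C) X).obj P))⟩⟩ :=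
      hX (Projective.over A) inferInstance
    obtain ⟨p, hp⟩ : ∃ p : (actionRight (C := C) X).obj P ⟶ A, r.i ≫ p = Projective.π A :=
      ⟨r.r ≫ Projective.π A, r.retract_assoc _⟩
    have h : p ≫ f = p ≫ g := by
      apply hom_ext_of_unitAt adj
      rw [Functor.map_comp, Functor.map_comp, hfg]
    rw [← cancel_epi (Projective.π A), ← hp, Category.assoc, h, Category.assoc]

/-- The internal hom functor of a closed `C`-projective `C`-generator is monadic. -/
theorem isEquivalence_comparison [Abelian C] [Abelian M] [(actionRight (C := C) X).Additive]
    [EnoughProjectives C] [EnoughProjectives M] (hX : IsCProjective C X) (hX' : IsCGenerator C X) :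
    (Monad.comparison adj).IsEquivalence := by
  have := adj.right_adjoint_additive
  have := hX.preservesEpimorphisms adj
  have := hX'.faithful adj
  -- Left exactness of `H` costs nothing, since right adjoints preserve limits.
  have : PreservesLimitsOfSize.{0, 0} H := adj.rightAdjoint_preservesLimits
  have := preservesFiniteColimits_of_preservesEpimorphisms H
  exact isEquivalence_comparison_of_faithful adj

end Closed

/-! ### Exact faithful left adjoints are comonadic -/

section Comonadicity

variable {C : Type u₁} [Category.{v₁} C] {M : Type u₂} [Category.{v₂} M]

lemma mono_map_unitAt {L : M ⥤ C} {R : C ⥤ M} (adj : L ⊣ R) (B : M) :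
    Mono (L.map (unitAt adj B)) :=
  mono_of_mono_fac (map_unitAt_comp_counitAt adj B)

/-- Dual Beck argument: the preimage of a comodule `(A, a)` is the equalizer in `M` of `R a` and the
unit at `R A`, which the left exact `L` preserves. -/
lemma exists_iso_cocomparison [Abelian M] {L : M ⥤ C} {R : C ⥤ M} (adj : L ⊣ R)
    [PreservesFiniteLimits L] (A : adj.toComonad.Coalgebra) :
    ∃ B : M, Nonempty ((Comonad.comparison adj).obj B ≅ A) := by
  let a : A.A ⟶ L.obj (R.obj A.A) := A.a
  have ha : a ≫ L.map (R.map a) = a ≫ L.map (unitAt adj (R.obj A.A)) := A.coassoc.symm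
  have hu : a ≫ counitAt adj A.A = 𝟙 _ := A.counit
  have hm : L.map (R.map a) ≫ L.map (R.map (counitAt adj A.A)) = 𝟙 _ := by
    rw [← Functor.map_comp, ← Functor.map_comp, hu, R.map_id, L.map_id]
  have : Mono (L.map (R.map a)) := mono_of_mono_fac hm
  let ι := equalizer.ι (R.map a) (unitAt adj (R.obj A.A))
  have hι : L.map ι ≫ L.map (R.map a) = L.map ι ≫ L.map (unitAt adj (R.obj A.A)) := by
    rw [← Functor.map_comp, equalizer.condition, Functor.map_comp]
  have hA : IsLimit (Fork.ofι a ha) := Comonad.beckEqualizer A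
  have hB : IsLimit (Fork.ofι (L.map ι) hι) :=
    isLimitForkMapOfIsLimit L _ (equalizerIsEqualizer _ _)
  let i : L.obj (equalizer (R.map a) (unitAt adj (R.obj A.A))) ≅ A.A :=
    hB.conePointUniqueUpToIso hA
  have hi : i.hom ≫ a = L.map ι :=
    hB.conePointUniqueUpToIso_hom_comp hA WalkingParallelPair.zero
  refine ⟨_, ⟨Comonad.Coalgebra.isoMk i ?_⟩⟩
  -- Compatibility with the coactions is tested after composing with `L R a`, a monomorphism split
  -- by the counit, where coassociativity applies.
  change L.map (unitAt adj _) ≫ L.map (R.map i.hom) = i.hom ≫ a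
  rw [← cancel_mono (L.map (R.map a)), Category.assoc, Category.assoc, ha, ← Functor.map_comp,
    ← R.map_comp, hi, ← L.map_comp, unitAt_naturality, L.map_comp, reassoc_of% hi]

variable [Abelian C] [Abelian M]

section LeftAdjoint

variable {L : M ⥤ C} {R : C ⥤ M} (adj : L ⊣ R)

include adj

/-- The unit at `B` is mono because the faithful `L` reflects monomorphisms, hence it is the kernel
of its cokernel. The comodule condition on `g` makes its transpose `A ⟶ R L B` vanish on that
cokernel, so it lifts to `B`. -/
lemma exists_map_eq_of_faithful_left [L.Faithful] [L.PreservesZeroMorphisms] {A B : M}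
    (g : L.obj A ⟶ L.obj B)
    (hg : L.map (unitAt adj A) ≫ L.map (R.map g) = g ≫ L.map (unitAt adj B)) :
    ∃ f : A ⟶ B, L.map f = g := by
  have := mono_map_unitAt adj B
  have : Mono (unitAt adj B) := L.mono_of_mono_map this
  have h : (unitAt adj A ≫ R.map g) ≫ cokernel.π (unitAt adj B) = 0 := by
    apply L.map_injective
    rw [Functor.map_comp, Functor.map_comp, hg, Category.assoc, ← Functor.map_comp,
      cokernel.condition, Functor.map_zero, Functor.map_zero, comp_zero]
  refine ⟨Abelian.monoLift (unitAt adj B) _ h, ?_⟩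
  rw [← cancel_mono (L.map (unitAt adj B)), ← Functor.map_comp, Abelian.monoLift_comp,
    Functor.map_comp, hg]

theorem isEquivalence_cocomparison_of_faithful [L.Additive] [L.Faithful]
    [PreservesFiniteLimits L] : (Comonad.comparison adj).IsEquivalence where
  full := ⟨fun {A B} g => by
    obtain ⟨f, hf⟩ := exists_map_eq_of_faithful_left adj g.f g.h
    exact ⟨f, Comonad.Coalgebra.Hom.ext hf⟩⟩
  essSurj := ⟨fun A => by
    obtain ⟨B, hB⟩ := exists_iso_cocomparison adj A
    exact ⟨B, hB⟩⟩

end LeftAdjoint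

end Comonadicity

/-! ### Exactness of internal cohoms -/

section Coclosed

variable {C : Type u₁} [Category.{v₁} C] [MonoidalCategory C]
  {M : Type u₂} [Category.{v₂} M] [MonoidalLeftAction C M] {X : M}
  {L : M ⥤ C} (adj : L ⊣ actionRight (C := C) X)

include adj

/-- The transpose of an embedding of `L A` into an injective `I` extends along `f`, because `I ▷ X`
is injective. Transposing back factors that embedding through `L f`. -/
lemma IsCInjective.preservesMonomorphisms [EnoughInjectives C] (hX : IsCInjective C X) :
    L.PreservesMonomorphisms where
  preserves {A B} f _ := by
    have : Injective ((actionRight (C := C) X).obj (Injective.under (L.obj A))) :=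
      hX _ inferInstance
    have h : L.map f ≫ (adj.homEquiv _ _).symm
        (Injective.factorThru (adj.homEquiv _ _ (Injective.ι (L.obj A))) f) =
          Injective.ι (L.obj A) := by
      rw [← adj.homEquiv_naturality_left_symm, Injective.comp_factorThru, Equiv.symm_apply_apply]
    exact mono_of_mono_fac h

/-- Maps into objects `I ▷ X` are detected by `L`, and an injective hull of `B` is a retract of one
of them. -/
lemma IsCCogenerator.faithful [EnoughInjectives M] (hX : IsCCogenerator C X) :
    L.Faithful where
  map_injective {A B f g} hfg := by
    obtain ⟨I, -, ⟨(r : Retract (Injective.under B) ((actionRight (C := C) X).obj I))⟩⟩ :=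
      hX (Injective.under B) inferInstance
    obtain ⟨p, hp⟩ : ∃ p : B ⟶ (actionRight (C := C) X).obj I, p ≫ r.r = Injective.ι B :=
      ⟨Injective.ι B ≫ r.i, by rw [Category.assoc, r.retract, Category.comp_id]⟩
    have h : f ≫ p = g ≫ p := by
      apply hom_ext_of_counitAt adj
      rw [Functor.map_comp, Functor.map_comp, hfg]
    rw [← cancel_mono (Injective.ι B), ← hp, reassoc_of% h]

/-- The internal cohom functor of a coclosed `C`-injective `C`-cogenerator is comonadic. -/
theorem isEquivalence_cocomparison [Abelian C] [Abelian M] [(actionRight (C := C) X).Additive]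
    [EnoughInjectives C] [EnoughInjectives M] (hX : IsCInjective C X) (hX' : IsCCogenerator C X) :
    (Comonad.comparison adj).IsEquivalence := by
  have := adj.left_adjoint_additive
  have := hX.preservesMonomorphisms adj
  have := hX'.faithful adj
  have : PreservesColimitsOfSize.{0, 0} L := adj.leftAdjoint_preservesColimits
  have := preservesFiniteLimits_of_preservesMonomorphisms L
  exact isEquivalence_cocomparison_of_faithful adj

end Coclosed

/-! ### Extended actions and Linton coequalizers -/

section Monads

variable {C : Type u₁} [Category.{v₁} C] [MonoidalCategory C]
  {D : Type u₂} [Category.{v₂} D] [MonoidalLeftAction C D]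

lemma kleisliToAlgebra_map_toKleisli (T : Monad D) {x y : D} (f : x ⟶ y) :
    (kleisliToAlgebra T).map ((Kleisli.Adjunction.toKleisli T).map f) = T.free.map f := by
  apply Monad.Algebra.Hom.ext
  change T.map (f ≫ T.η.app y) ≫ T.μ.app y = T.map f
  rw [Functor.map_comp, Category.assoc, T.right_unit]
  exact Category.comp_id _

/-! ### The Kleisli embedding as a strong module functor -/

section Comparison

variable {E : Type u} [Category.{v} E] [MonoidalLeftAction C E] {F : D ⥤ E} {U : E ⥤ D}
  (adj : F ⊣ U) [F.LeftLinear C]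

/-- Transposition `f ↦ F f ≫ ε` turns the action on Kleisli morphisms into the action on `E`, up to
the coherence of `F`; the coherence of the monad is built from exactly the right adjoint's lineator
and `μₗ F`. -/
lemma actionHomRight_transpose_comp_lineator (c : C) {x y : D} (f : x ⟶ U.obj (F.obj y)) :
    c ⊴ₗ (F.map f ≫ counitAt adj (F.obj y)) ≫ μₗ F c y =
      μₗ F c x ≫ F.map (c ⊴ₗ f ≫ rightAdjointLineator adj c (F.obj y) ≫ U.map (μₗ F c y)) ≫
        counitAt adj (F.obj (c ⊙ₗ y)) := by
  rw [F.map_comp, F.map_comp, Category.assoc, Category.assoc, counitAt_naturality,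
    ← Category.assoc (F.map (rightAdjointLineator _ _ _)), map_rightAdjointLineator,
    ← μₗ_naturality_right_assoc, Category.assoc, Functor.LeftLinear.μₗ_comp_δₗ_assoc,
    actionHomRight_comp, Category.assoc]

/-- The Kleisli embedding factors through `E` by transposition, which lets it inherit its structure
from `F` and the comparison functor. -/
lemma kleisliToAlgebra_map_eq {x y : Kleisli adj.toMonad} (f : x ⟶ y) :
    (kleisliToAlgebra adj.toMonad).map f =
      (Monad.comparison adj).map (F.map f.of ≫ counitAt adj (F.obj y.of)) :=
  Monad.Algebra.Hom.ext (U.map_comp _ _).symm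

/-- If the comparison functor is a strong `C`-module functor, then so is the embedding of the
Kleisli category into the Eilenberg-Moore category. -/
@[reducible]
noncomputable def kleisliToAlgebraLeftLinear [MonoidalLeftAction C adj.toMonad.Algebra]
    [(Monad.comparison adj).LeftLinear C] : (kleisliToAlgebra adj.toMonad).LeftLinear C :=
  letI : (F ⋙ Monad.comparison adj).LeftLinear C := compLeftLinear F (Monad.comparison adj)
  letI : (kleisliToAlgebra adj.toMonad).LaxLeftLinear C :=
    -- On objects the embedding agrees definitionally with `F` followed by the comparison functor,
    -- so the coherence can be reused. The other axioms involve only Kleisli morphisms coming from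
    -- `D`; naturality in general Kleisli morphisms is the new content.
    { μₗ c x := μₗ (F ⋙ Monad.comparison adj) c x.of
      μₗ_naturality_left {c c'} f x := by
        refine (μₗ_naturality_left (F ⋙ Monad.comparison adj) f x.of).trans ?_
        exact congr_arg (_ ≫ ·) (kleisliToAlgebra_map_toKleisli _ (f ⊵ₗ x.of)).symm
      μₗ_naturality_right c {x y} f := by
        rw [kleisliToAlgebra_map_eq, kleisliToAlgebra_map_eq]
        change c ⊴ₗ (Monad.comparison adj).map _ ≫
            μₗ (Monad.comparison adj) c (F.obj y.of) ≫ (Monad.comparison adj).map (μₗ F c y.of) =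
          (μₗ (Monad.comparison adj) c (F.obj x.of) ≫ (Monad.comparison adj).map (μₗ F c x.of)) ≫
            (Monad.comparison adj).map (F.map (c ⊴ₗ f.of ≫
              rightAdjointLineator adj c (F.obj y.of) ≫ U.map (μₗ F c y.of)) ≫ counitAt adj _)
        rw [μₗ_naturality_right_assoc, ← Functor.map_comp, Category.assoc, ← Functor.map_comp]
        congr 2
        exact actionHomRight_transpose_comp_lineator adj c f.of
      μₗ_associativity c c' x := by
        refine Eq.trans ?_ (μₗ_associativity (F ⋙ Monad.comparison adj) c c' x.of)
        exact congr_arg (_ ≫ ·) (kleisliToAlgebra_map_toKleisli _ (αₗ c c' x.of).hom)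
      μₗ_unitality x := by
        refine (μₗ_unitality (F ⋙ Monad.comparison adj) x.of).trans ?_
        exact congr_arg (_ ≫ ·) (kleisliToAlgebra_map_toKleisli _ (λₗ[C] x.of).hom).symm }
  haveI (c : C) (x : Kleisli adj.toMonad) : IsIso (μₗ (kleisliToAlgebra adj.toMonad) c x) :=
    inferInstanceAs (IsIso (μₗ (F ⋙ Monad.comparison adj) c x.of))
  leftLinearOfLax _

end Comparison

/-! ### Linton coequalizers for right exact extended actions -/

section Linton

variable (T : Monad D) [LaxModuleMonad C T] [MonoidalLeftAction C T.Algebra]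
  [(kleisliToAlgebra T).LeftLinear C]

/-- The isomorphism `c ▶ T x ≅ T (c ▷ x)` of an extended action. -/
def extendedIso (c : C) (x : D) : c ⊙ₗ T.free.obj x ≅ T.free.obj (c ⊙ₗ x) :=
  Functor.LeftLinear.μₗIso (kleisliToAlgebra T) c (Kleisli.mk T x)

lemma extendedIso_hom_naturality (c : C) {x y : D} (f : x ⟶ y) :
    c ⊴ₗ T.free.map f ≫ (extendedIso T c y).hom =
      (extendedIso T c x).hom ≫ T.free.map (c ⊴ₗ f) := by
  have h := μₗ_naturality_right (kleisliToAlgebra T) c ((Kleisli.Adjunction.toKleisli T).map f)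
  have h' : c ⊴ₗ (Kleisli.Adjunction.toKleisli T).map f =
      (Kleisli.Adjunction.toKleisli T).map (c ⊴ₗ f) := kleisliWhisker_toKleisli T c f
  rw [h'] at h
  have h₁ := kleisliToAlgebra_map_toKleisli T f
  have h₂ := kleisliToAlgebra_map_toKleisli T (c ⊴ₗ f)
  rw [← h₁, ← h₂]
  exact h

/-- If the action on `T`-modules is extended, then `T.free` is a strong `C`-module functor. -/
@[reducible]
noncomputable def freeLeftLinear : T.free.LeftLinear C :=
  letI : T.free.LaxLeftLinear C :=
    { μₗ c x := (extendedIso T c x).hom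
      μₗ_naturality_left {c c'} f x := by
        refine (μₗ_naturality_left (kleisliToAlgebra T) f (Kleisli.mk T x)).trans ?_
        exact congr_arg (_ ≫ ·) (kleisliToAlgebra_map_toKleisli T (f ⊵ₗ x))
      μₗ_naturality_right c {x y} f := extendedIso_hom_naturality T c f
      μₗ_associativity c c' x := by
        refine Eq.trans ?_ (μₗ_associativity (kleisliToAlgebra T) c c' (Kleisli.mk T x))
        exact congr_arg (_ ≫ ·) (kleisliToAlgebra_map_toKleisli T (αₗ c c' x).hom).symm
      μₗ_unitality x := by
        refine (μₗ_unitality (kleisliToAlgebra T) (Kleisli.mk T x)).trans ?_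
        exact congr_arg (_ ≫ ·) (kleisliToAlgebra_map_toKleisli T (λₗ[C] x).hom) }
  haveI (c : C) (x : D) : IsIso (μₗ T.free c x) :=
    inferInstanceAs (IsIso (extendedIso T c x).hom)
  leftLinearOfLax _

/-- If the action on `T`-modules is extended, then the forgetful functor is a lax `C`-module
functor. -/
@[reducible]
noncomputable def forgetLaxLeftLinear : T.forget.LaxLeftLinear C :=
  letI := freeLeftLinear (C := C) T
  rightAdjointLax T.adj

lemma counitAt_adj (A : T.Algebra) : counitAt T.adj A = Monad.FreeCoequalizer.π A :=
  Monad.Algebra.Hom.ext ((congr_arg (· ≫ A.a) (T.map_id A.A)).trans (Category.id_comp A.a))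

/-- The adjunct of a doctrinal lax coherence is the oplax coherence of the left adjoint followed by
the counit; for the free-forgetful adjunction the counit at `A` is the canonical presentation `T A ⟶
A`. -/
lemma lintonDesc_lineator (c : C) (A : T.Algebra) :
    letI := forgetLaxLeftLinear (C := C) T
    lintonDesc T c A (c ⊙ₗ A) (μₗ T.forget c A) =
      (extendedIso T c A.A).inv ≫ c ⊴ₗ Monad.FreeCoequalizer.π A := by
  let _ := freeLeftLinear (C := C) T
  have h := map_rightAdjointLineator T.adj c A
  rw [counitAt_adj, counitAt_adj] at h
  refine Eq.trans (Monad.Algebra.Hom.ext rfl) (h.trans ?_)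
  exact congr_arg (· ≫ c ⊴ₗ Monad.FreeCoequalizer.π A) (IsIso.Iso.inv_hom (extendedIso T c A.A))

lemma extendedIso_hom_comp_lintonLeft (c : C) (A : T.Algebra) :
    (extendedIso T c (T.obj A.A)).hom ≫ lintonLeft T c A =
      c ⊴ₗ Monad.FreeCoequalizer.topMap A ≫ (extendedIso T c A.A).hom :=
  (extendedIso_hom_naturality T c A.a).symm

/-- The other half of the identification of the Linton pair with the `c ▶ -` image of the canonical
presentation. This half needs naturality in a Kleisli morphism that does not come from `D`. -/
lemma extendedIso_hom_comp_lintonRight (c : C) (A : T.Algebra) :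
    (extendedIso T c (T.obj A.A)).hom ≫ lintonRight T c A =
      c ⊴ₗ Monad.FreeCoequalizer.bottomMap A ≫ (extendedIso T c A.A).hom := by
  -- The identity of `T A` read as a Kleisli morphism `T A ⟶ A`: the embedding sends it to `μ_A`,
  -- and acting on it by `c` produces the coherence of `T`.
  let f : Kleisli.mk T (T.obj A.A) ⟶ Kleisli.mk T A.A := Kleisli.Hom.mk (𝟙 (T.obj A.A))
  have hf : (kleisliToAlgebra T).map f = Monad.FreeCoequalizer.bottomMap A := by
    apply Monad.Algebra.Hom.ext
    change T.map (𝟙 (T.obj A.A)) ≫ T.μ.app A.A = T.μ.app A.A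
    rw [T.map_id]
    exact Category.id_comp _
  have hf' : c ⊴ₗ f = Kleisli.Hom.mk (μₗ T.toFunctor c A.A) := by
    apply Kleisli.hom_ext
    change c ⊴ₗ 𝟙 (T.obj A.A) ≫ μₗ T.toFunctor c A.A = μₗ T.toFunctor c A.A
    rw [actionHomRight_id, Category.id_comp]
  have h := μₗ_naturality_right (kleisliToAlgebra T) c f
  rw [hf'] at h
  rw [← hf]
  exact h.symm

/-- An extended action whose functors `c ▶ -` are right exact is given by Linton coequalizers. -/
theorem isLintonAction_of_rightExact
    (hC : ∀ c : C, PreservesFiniteColimits (actionLeft T.Algebra c)) : IsLintonAction C T := by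
  refine ⟨forgetLaxLeftLinear (C := C) T, fun c A => ?_⟩
  rw [lintonDesc_lineator]
  -- Right exactness enters only here: `c ▶ -` preserves the presentation of `A` by free modules,
  -- which is then carried to the Linton cofork along `extendedIso`.
  have hA := isColimitCoforkMapOfIsColimit (actionLeft T.Algebra c) _
    (Monad.beckAlgebraCoequalizer A)
  have w : lintonLeft T c A ≫ (extendedIso T c A.A).inv ≫ c ⊴ₗ Monad.FreeCoequalizer.π A =
      lintonRight T c A ≫ (extendedIso T c A.A).inv ≫ c ⊴ₗ Monad.FreeCoequalizer.π A := by
    rw [← cancel_epi (extendedIso T c (T.obj A.A)).hom,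
      reassoc_of% extendedIso_hom_comp_lintonLeft T c A,
      reassoc_of% extendedIso_hom_comp_lintonRight T c A, Iso.hom_inv_id_assoc,
      ← actionHomRight_comp, Monad.FreeCoequalizer.condition,
      actionHomRight_comp]
  exact ⟨w, ⟨Cofork.isColimitOfIsos _ hA _ (extendedIso T c (T.obj A.A)) (extendedIso T c A.A)
    (Iso.refl _) (extendedIso_hom_comp_lintonLeft T c A) (extendedIso_hom_comp_lintonRight T c A)
    (congr_arg ((extendedIso T c A.A).inv ≫ ·) (Category.comp_id _))⟩⟩

end Linton

end Monads

/-! ### Extended coactions and Linton equalizers -/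

section Comonads

variable {C : Type u₁} [Category.{v₁} C] [MonoidalCategory C]
  {D : Type u₂} [Category.{v₂} D] [MonoidalLeftAction C D]

lemma cokleisliToCoalgebra_map_toCokleisli (S : Comonad D) {x y : D} (f : x ⟶ y) :
    (cokleisliToCoalgebra S).map ((Cokleisli.Adjunction.toCokleisli S).map f) =
      S.cofree.map f := by
  apply Comonad.Coalgebra.Hom.ext
  change S.δ.app x ≫ S.map (S.ε.app x ≫ f) = S.map f
  rw [Functor.map_comp, ← Category.assoc, S.right_counit]
  exact Category.id_comp _

/-! ### The co-Kleisli embedding as a strong module functor -/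

section Cocomparison

variable {E : Type u} [Category.{v} E] [MonoidalLeftAction C E] {F : E ⥤ D} {U : D ⥤ E}
  (adj : F ⊣ U) [U.LeftLinear C]

/-- Under the transposition `f ↦ η ≫ U f`, the action on co-Kleisli morphisms becomes the action on
`E`, up to the coherence of `U`. -/
lemma colineator_comp_actionHomRight_transpose (c : C) {x y : D} (f : F.obj (U.obj x) ⟶ y) :
    (unitAt adj (U.obj (c ⊙ₗ x)) ≫
      U.map ((F.map (δₗ U c x) ≫ leftAdjointLineator adj c (U.obj x)) ≫ c ⊴ₗ f)) ≫ δₗ U c y =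
      δₗ U c x ≫ c ⊴ₗ (unitAt adj (U.obj x) ≫ U.map f) := by
  rw [U.map_comp, U.map_comp, Category.assoc, Category.assoc, Category.assoc,
    δₗ_naturality_right, ← Category.assoc (unitAt _ _), unitAt_naturality, Category.assoc,
    ← Category.assoc (unitAt _ _), map_leftAdjointLineator, Category.assoc,
    Functor.LeftLinear.μₗ_comp_δₗ_assoc, actionHomRight_comp]

lemma cokleisliToCoalgebra_map_eq {x y : Cokleisli adj.toComonad} (f : x ⟶ y) :
    (cokleisliToCoalgebra adj.toComonad).map f =
      (Comonad.comparison adj).map (unitAt adj (U.obj x.of) ≫ U.map f.of) :=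
  Comonad.Coalgebra.Hom.ext (F.map_comp _ _).symm

/-- If the comparison functor is a strong `C`-module functor, then so is the embedding of the
co-Kleisli category into the Eilenberg-Moore category. -/
@[reducible]
noncomputable def cokleisliToCoalgebraLeftLinear [MonoidalLeftAction C adj.toComonad.Coalgebra]
    [(Comonad.comparison adj).LeftLinear C] :
    (cokleisliToCoalgebra adj.toComonad).LeftLinear C :=
  letI : (U ⋙ Comonad.comparison adj).LeftLinear C := compLeftLinear U (Comonad.comparison adj)
  letI : (cokleisliToCoalgebra adj.toComonad).OplaxLeftLinear C :=
    -- The oplax coherence is borrowed from `U` followed by the comparison functor; as in the monad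
    -- case, only naturality in general co-Kleisli morphisms needs an argument.
    { δₗ c x := δₗ (U ⋙ Comonad.comparison adj) c x.of
      δₗ_naturality_left {c c'} f x := by
        refine Eq.trans ?_ (δₗ_naturality_left (U ⋙ Comonad.comparison adj) f x.of)
        exact congr_arg (· ≫ _) (cokleisliToCoalgebra_map_toCokleisli _ (f ⊵ₗ x.of))
      δₗ_naturality_right c {x y} f := by
        rw [cokleisliToCoalgebra_map_eq, cokleisliToCoalgebra_map_eq]
        change (Comonad.comparison adj).map (unitAt adj _ ≫ U.map
              ((F.map (δₗ U c x.of) ≫ leftAdjointLineator adj c (U.obj x.of)) ≫ c ⊴ₗ f.of)) ≫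
            (Comonad.comparison adj).map (δₗ U c y.of) ≫
              δₗ (Comonad.comparison adj) c (U.obj y.of) =
          ((Comonad.comparison adj).map (δₗ U c x.of) ≫
            δₗ (Comonad.comparison adj) c (U.obj x.of)) ≫ c ⊴ₗ (Comonad.comparison adj).map _
        rw [Category.assoc ((Comonad.comparison adj).map (δₗ U c x.of)), ← δₗ_naturality_right,
          ← Functor.map_comp_assoc, ← Functor.map_comp_assoc]
        congr 2
        exact colineator_comp_actionHomRight_transpose adj c f.of
      δₗ_associativity c c' x := by
        refine (δₗ_associativity (U ⋙ Comonad.comparison adj) c c' x.of).trans ?_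
        exact congr_arg (· ≫ _) (cokleisliToCoalgebra_map_toCokleisli _ (αₗ c c' x.of).hom).symm
      δₗ_unitality_inv x := by
        refine (δₗ_unitality_inv (U ⋙ Comonad.comparison adj) x.of).trans ?_
        exact congr_arg (· ≫ _) (cokleisliToCoalgebra_map_toCokleisli _ (λₗ[C] x.of).inv).symm }
  haveI (c : C) (x : Cokleisli adj.toComonad) :
      IsIso (δₗ (cokleisliToCoalgebra adj.toComonad) c x) :=
    inferInstanceAs (IsIso (δₗ (U ⋙ Comonad.comparison adj) c x.of))
  leftLinearOfOplax _

end Cocomparison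

/-! ### Linton equalizers for left exact extended coactions -/

section Colinton

variable (S : Comonad D) [OplaxModuleComonad C S] [MonoidalLeftAction C S.Coalgebra]
  [(cokleisliToCoalgebra S).LeftLinear C]

/-- The isomorphism `S (c ▷ x) ≅ c ▶ S x` of an extended coaction. -/
def coextendedIso (c : C) (x : D) : S.cofree.obj (c ⊙ₗ x) ≅ c ⊙ₗ S.cofree.obj x :=
  (Functor.LeftLinear.μₗIso (cokleisliToCoalgebra S) c (Cokleisli.mk S x)).symm

lemma coextendedIso_hom_naturality (c : C) {x y : D} (f : x ⟶ y) :
    S.cofree.map (c ⊴ₗ f) ≫ (coextendedIso S c y).hom =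
      (coextendedIso S c x).hom ≫ c ⊴ₗ S.cofree.map f := by
  have h := δₗ_naturality_right (cokleisliToCoalgebra S) c
    ((Cokleisli.Adjunction.toCokleisli S).map f)
  have h' : c ⊴ₗ (Cokleisli.Adjunction.toCokleisli S).map f =
      (Cokleisli.Adjunction.toCokleisli S).map (c ⊴ₗ f) := cokleisliWhisker_toCokleisli S c f
  rw [h'] at h
  have h₁ := cokleisliToCoalgebra_map_toCokleisli S f
  have h₂ := cokleisliToCoalgebra_map_toCokleisli S (c ⊴ₗ f)
  rw [← h₁, ← h₂]
  exact h

/-- If the action on `S`-comodules is extended, then `S.cofree` is a strong `C`-module functor. -/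
@[reducible]
noncomputable def cofreeLeftLinear : S.cofree.LeftLinear C :=
  letI : S.cofree.OplaxLeftLinear C :=
    { δₗ c x := (coextendedIso S c x).hom
      δₗ_naturality_left {c c'} f x := by
        refine Eq.trans ?_ (δₗ_naturality_left (cokleisliToCoalgebra S) f (Cokleisli.mk S x))
        exact congr_arg (· ≫ _) (cokleisliToCoalgebra_map_toCokleisli S (f ⊵ₗ x)).symm
      δₗ_naturality_right c {x y} f := coextendedIso_hom_naturality S c f
      δₗ_associativity c c' x := by
        refine (δₗ_associativity (cokleisliToCoalgebra S) c c' (Cokleisli.mk S x)).trans ?_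
        exact congr_arg (· ≫ _) (cokleisliToCoalgebra_map_toCokleisli S (αₗ c c' x).hom)
      δₗ_unitality_inv x := by
        refine (δₗ_unitality_inv (cokleisliToCoalgebra S) (Cokleisli.mk S x)).trans ?_
        exact congr_arg (· ≫ _) (cokleisliToCoalgebra_map_toCokleisli S (λₗ[C] x).inv) }
  haveI (c : C) (x : D) : IsIso (δₗ S.cofree c x) :=
    inferInstanceAs (IsIso (coextendedIso S c x).hom)
  leftLinearOfOplax _

/-- If the action on `S`-comodules is extended, then the forgetful functor is an oplax `C`-module
functor. -/
@[reducible]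
noncomputable def forgetOplaxLeftLinear : S.forget.OplaxLeftLinear C :=
  letI := cofreeLeftLinear (C := C) S
  leftAdjointOplax S.adj

lemma unitAt_adj (A : S.Coalgebra) : unitAt S.adj A = Comonad.CofreeEqualizer.ι A :=
  Comonad.Coalgebra.Hom.ext ((congr_arg (A.a ≫ ·) (S.map_id A.A)).trans (Category.comp_id A.a))

lemma colintonLift_colineator (c : C) (A : S.Coalgebra) :
    letI := forgetOplaxLeftLinear (C := C) S
    colintonLift S c A (c ⊙ₗ A) (δₗ S.forget c A) =
      c ⊴ₗ Comonad.CofreeEqualizer.ι A ≫ (coextendedIso S c A.A).inv := by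
  let _ := cofreeLeftLinear (C := C) S
  have h := map_leftAdjointLineator S.adj c A
  rw [unitAt_adj, unitAt_adj] at h
  refine Eq.trans (Comonad.Coalgebra.Hom.ext rfl) (h.trans ?_)
  exact congr_arg (c ⊴ₗ Comonad.CofreeEqualizer.ι A ≫ ·)
    (IsIso.Iso.inv_hom (coextendedIso S c A.A))

lemma colintonLeft_comp_coextendedIso_hom (c : C) (A : S.Coalgebra) :
    colintonLeft S c A ≫ (coextendedIso S c (S.obj A.A)).hom =
      (coextendedIso S c A.A).hom ≫ c ⊴ₗ Comonad.CofreeEqualizer.topMap A :=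
  coextendedIso_hom_naturality S c A.a

lemma colintonRight_comp_coextendedIso_hom (c : C) (A : S.Coalgebra) :
    colintonRight S c A ≫ (coextendedIso S c (S.obj A.A)).hom =
      (coextendedIso S c A.A).hom ≫ c ⊴ₗ Comonad.CofreeEqualizer.bottomMap A := by
  -- The identity of `S A` as a co-Kleisli morphism `A ⟶ S A`: it embeds as the comultiplication,
  -- and acting on it by `c` gives the coherence of `S`.
  let f : Cokleisli.mk S A.A ⟶ Cokleisli.mk S (S.obj A.A) := Cokleisli.Hom.mk (𝟙 (S.obj A.A))
  have hf : (cokleisliToCoalgebra S).map f = Comonad.CofreeEqualizer.bottomMap A := by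
    apply Comonad.Coalgebra.Hom.ext
    change S.δ.app A.A ≫ S.map (𝟙 (S.obj A.A)) = S.δ.app A.A
    rw [S.map_id]
    exact Category.comp_id _
  have hf' : c ⊴ₗ f = Cokleisli.Hom.mk (δₗ S.toFunctor c A.A) := by
    apply Cokleisli.hom_ext
    change δₗ S.toFunctor c A.A ≫ c ⊴ₗ 𝟙 (S.obj A.A) = δₗ S.toFunctor c A.A
    rw [actionHomRight_id, Category.comp_id]
  have h := δₗ_naturality_right (cokleisliToCoalgebra S) c f
  rw [hf'] at h
  rw [← hf]
  exact h

/-- An extended coaction whose functors `c ▶ -` are left exact is given by Linton equalizers. -/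
theorem isColintonAction_of_leftExact
    (hC : ∀ c : C, PreservesFiniteLimits (actionLeft S.Coalgebra c)) : IsColintonAction C S := by
  refine ⟨forgetOplaxLeftLinear (C := C) S, fun c A => ?_⟩
  rw [colintonLift_colineator]
  -- Left exactness of `c ▶ -` preserves the canonical equalizer of cofree comodules that computes
  -- `A`.
  have hA := isLimitForkMapOfIsLimit (actionLeft S.Coalgebra c) _
    (Comonad.beckCoalgebraEqualizer A)
  have w : (c ⊴ₗ Comonad.CofreeEqualizer.ι A ≫ (coextendedIso S c A.A).inv) ≫
        colintonLeft S c A =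
      (c ⊴ₗ Comonad.CofreeEqualizer.ι A ≫ (coextendedIso S c A.A).inv) ≫
        colintonRight S c A := by
    rw [← cancel_mono (coextendedIso S c (S.obj A.A)).hom]
    simp only [Category.assoc]
    rw [colintonLeft_comp_coextendedIso_hom, colintonRight_comp_coextendedIso_hom,
      Iso.inv_hom_id_assoc, Iso.inv_hom_id_assoc, ← actionHomRight_comp,
      Comonad.CofreeEqualizer.condition, actionHomRight_comp]
  refine ⟨w, ⟨Fork.isLimitOfIsos _ hA _ (coextendedIso S c A.A).symm
    (coextendedIso S c (S.obj A.A)).symm (Iso.refl _) ?_ ?_ (Category.id_comp _)⟩⟩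
  · exact (Iso.inv_comp_eq _).2 ((Iso.eq_comp_inv _).2
      (colintonLeft_comp_coextendedIso_hom S c A) |>.trans (Category.assoc _ _ _))
  · exact (Iso.inv_comp_eq _).2 ((Iso.eq_comp_inv _).2
      (colintonRight_comp_coextendedIso_hom S c A) |>.trans (Category.assoc _ _ _))

end Colinton

end Comonads

/-! ### The comparison functors as equivalences of module categories -/

section ComparisonLinear

variable {k : Type w} [CommRing k] {D : Type u₂} [Category.{v₂} D] [Preadditive D]
  {E : Type u} [Category.{v} E] [Preadditive E] {F : D ⥤ E} {U : E ⥤ D} (adj : F ⊣ U)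

lemma comparison_additive [F.Additive] : (Monad.comparison adj).Additive :=
  have := adj.right_adjoint_additive
  { map_add := Monad.Algebra.Hom.ext U.map_add }

lemma comparison_linear [Linear k D] [Linear k E] [F.Additive] [F.Linear k] :
    (Monad.comparison adj).Linear k :=
  have : U.Linear k := rightAdjoint_linear adj
  { map_smul f r := Monad.Algebra.Hom.ext (U.map_smul r f) }

lemma cocomparison_additive [U.Additive] : (Comonad.comparison adj).Additive :=
  have := adj.left_adjoint_additive
  { map_add := Comonad.Coalgebra.Hom.ext F.map_add }

lemma cocomparison_linear [Linear k D] [Linear k E] [U.Additive] [U.Linear k] :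
    (Comonad.comparison adj).Linear k :=
  have : F.Linear k := leftAdjoint_linear adj
  { map_smul f r := Comonad.Coalgebra.Hom.ext (F.map_smul r f) }

end ComparisonLinear

end ModuleReconstruction

theorem theorem5p1 {k : Type w} [CommRing k]
    (C : Type u₁) [Category.{v₁} C] [MonoidalCategory C] [Abelian C] [Linear k C]
    [MonoidalPreadditive C] [MonoidalLinear k C]
    (M : Type u₂) [Category.{v₂} M] [Abelian M] [Linear k M]
    [MonoidalLeftAction C M] [ModuleReconstruction.LinearLeftAction k C M] (X : M) :
    (EnoughProjectives C → EnoughProjectives M →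
      ∀ (H : M ⥤ C) (adj : actionRight (C := C) X ⊣ H),
        ModuleReconstruction.IsCProjective C X → ModuleReconstruction.IsCGenerator C X →
        ∃ act : MonoidalLeftAction C adj.toMonad.Algebra,
          ModuleReconstruction.LinearLeftAction k C adj.toMonad.Algebra ∧
          ModuleReconstruction.IsExtendedAction C adj.toMonad ∧
          ModuleReconstruction.IsModuleEquivalence k C (Monad.comparison adj) ∧
          ((∀ c : C, PreservesFiniteColimits (actionLeft M c)) →
            ModuleReconstruction.IsLintonAction C adj.toMonad)) ∧
    (EnoughInjectives C → EnoughInjectives M →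
      ∀ (L : M ⥤ C) (adj : L ⊣ actionRight (C := C) X),
        ModuleReconstruction.IsCInjective C X → ModuleReconstruction.IsCCogenerator C X →
        ∃ act : MonoidalLeftAction C adj.toComonad.Coalgebra,
          ModuleReconstruction.LinearLeftAction k C adj.toComonad.Coalgebra ∧
          ModuleReconstruction.IsExtendedCoaction C adj.toComonad ∧
          ModuleReconstruction.IsModuleEquivalence k C (Comonad.comparison adj) ∧
          ((∀ c : C, PreservesFiniteLimits (actionLeft M c)) →
            ModuleReconstruction.IsColintonAction C adj.toComonad)) := by
  open ModuleReconstruction in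
  refine ⟨fun _ _ H adj hX hX' => ?_, fun _ _ L adj hX hX' => ?_⟩
  · have := isEquivalence_comparison adj hX hX'
    have := comparison_additive adj
    have := comparison_linear (k := k) adj
    let e := (Monad.comparison adj).asEquivalence
    -- The action is defined by transport from `M`, not by constructing coequalizers; for this
    -- reason the extended structure exists with no exactness assumption on `c ▷ -`.
    let act := transportAction (C := C) e
    let _ : (Monad.comparison adj).LeftLinear C := transportLeftLinear e
    let _ := kleisliToAlgebraLeftLinear (C := C) adj
    have : e.functor.Additive := ‹(Monad.comparison adj).Additive›
    have : e.functor.Linear k := ‹(Monad.comparison adj).Linear k›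
    exact ⟨act, transport_linear e k, ⟨inferInstance⟩,
      ⟨inferInstance, inferInstance, inferInstance, ⟨inferInstance⟩⟩,
      fun h => isLintonAction_of_rightExact adj.toMonad fun c =>
        transport_preservesFiniteColimits e c⟩
  · have := isEquivalence_cocomparison adj hX hX'
    have := cocomparison_additive adj
    have := cocomparison_linear (k := k) adj
    let e := (Comonad.comparison adj).asEquivalence
    let act := transportAction (C := C) e
    let _ : (Comonad.comparison adj).LeftLinear C := transportLeftLinear e
    let _ := cokleisliToCoalgebraLeftLinear (C := C) adj
    have : e.functor.Additive := ‹(Comonad.comparison adj).Additive›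
    have : e.functor.Linear k := ‹(Comonad.comparison adj).Linear k›
    exact ⟨act, transport_linear e k, ⟨inferInstance⟩,
      ⟨inferInstance, inferInstance, inferInstance, ⟨inferInstance⟩⟩,
      fun h => isColintonAction_of_leftExact adj.toComonad fun c =>
        transport_preservesFiniteLimits e c⟩
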